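/- Let $N\ge 1$ objects with absolute ranks $1,\dots,N$ (1 is the best) appear one by one in uniformly random order at moments $1,\dots,N$; the relative rank $R_n$ is the rank of the $n$-th object among the first $n$. Let $u_N=0$ and $u_n=\frac1{n+1}\max\{\frac{n+1}{N},u_{n+1}\}+\frac{n}{n+1}u_{n+1}$ for $0\le n<N$, and let $n^*$ be the smallest $n$ with $n/N\ge u_n$. Player 1 plays her optimal strategy in the classical secretary problem: she takes the first object of relative rank 1 appearing at or after moment $n^*$. Player 2 then sees all the other objects in the same order; he observes only the rank of each object among those he has seen so far, may accept at most one object, only when it appears, and his reward is 1 if it has absolute rank 1, otherwise 0. A candidate is an object that is the best Player 2 has seen so far; a decision point is the appearance of a candidate. For a possible history $h$ of Player 2 ending at a decision point, let $p_h$ be the conditional probability, given $h$, that the current candidate has relative rank 1 among all objects that have appeared (this is $p_{m,n,H}$ when the candidate is the $m$-th one seen after moment $n^*$ and appears at moment $n$). For $n^*<n\le N$ let $$q_n=\frac{S_{2,n}}{1+S_{2,n}-S_{1,n}},\qquad S_{1,n}=\sum_{k=n+1}^N\frac1{k-1},\qquad S_{2,n}=\sum_{k=n+1}^N\frac{n-1}{(k-1)(k-2)}.$$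 The one-step look-ahead (OSLA) rule accepts a candidate if and only if the conditional expected reward from accepting it is at least the conditional expected reward from rejecting it and accepting the next candidate that appears (reward 0 if there is none). Then, for decision points from $n^*$ on, i.e. those at which the candidate is the $j$-th object seen by Player 2 with $j\ge n^*$: (i) the candidate necessarily appears at moment $n=j+1\le N$, so Player 2 knows $n>n^*$; (ii) $q_n$ is strictly decreasing in $n$ for $n^*<n\le N$, and $p_h$ strictly increases from a decision point to any later one; (iii) the OSLA rule accepts the candidate at moment $n$ with history $h$ if and only if $p_h\ge q_n$; (iv) the stopping sets are closed: if the OSLA rule accepts at a decision point, it accepts at every later decision point; (v) the OSLA rule is optimal: given any history of Player 2 consisting of at least $n^*$ seen objects of which all but the last have been rejected, no strategy from there on has a larger conditional expected reward than the OSLA rule; in particular, replacing any strategy of Player 2 by the OSLA rule from the $n^*$-th object he sees onward does not decrease his expected reward in the whole game. Moreover, accepting a candidate at moment $n$ is optimal (its expected reward is at least that of every continuation after rejection) if and only if $p_h\ge q_n$. -/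

import Mathlib

open Finset

noncomputable section

namespace SecretaryGame

/-! `N` objects appear in uniformly random order: the sample space is the set of all permutations
`ω` of `Fin N` with the uniform distribution. Moments are counted from `1` to `N`. -/

/-- The absolute rank (`1` is the best) of the object appearing at moment `n`, `1 ≤ n ≤ N`. -/
def absRank {N : ℕ} (ω : Equiv.Perm (Fin N)) (n : ℕ) : ℕ :=
  if h : 0 < n ∧ n ≤ N then (ω ⟨n - 1, by omega⟩ : ℕ) + 1 else 0

/-- The relative rank of the object appearing at moment `n` among the first `n` objects. -/
def relRank {N : ℕ} (ω : Equiv.Perm (Fin N)) (n : ℕ) : ℕ :=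
  #{i ∈ Icc 1 n | absRank ω i ≤ absRank ω n}

/-- Conditional probability `P(E | F)` under the uniform distribution on permutations. -/
def condProb {N : ℕ} (E F : Set (Equiv.Perm (Fin N))) : ℝ :=
  ((E ∩ F).ncard : ℝ) / (F.ncard : ℝ)

/-! ### Player 1: the classical secretary problem -/

/-- The optimal probability that Player 1 selects the best object after having rejected
the first `n` objects (backward induction, zero after the last object). -/
def u (N n : ℕ) : ℝ :=
  if n < N then
    1 / ((n : ℝ) + 1) * max (((n : ℝ) + 1) / N) (u N (n + 1))
      + (n : ℝ) / ((n : ℝ) + 1) * u N (n + 1)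
  else 0
termination_by N - n

/-- Player 1's threshold `n*`: the smallest `n` with `n / N ≥ u_n`. -/
def nStar (N : ℕ) : ℕ := sInf {n : ℕ | u N n ≤ (n : ℝ) / N}

/-- The moment at which Player 1 accepts an object: the first moment from `n*` on at which an
object of relative rank 1 appears, and `N + 1` if there is no such moment. -/
def mu0 {N : ℕ} (ω : Equiv.Perm (Fin N)) : ℕ :=
  sInf ({n : ℕ | nStar N ≤ n ∧ n ≤ N ∧ relRank ω n = 1} ∪ {N + 1})

/-! ### Player 2: he sees all objects except the one taken by Player 1, in the same order -/

/-- The number of objects that Player 2 sees. -/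
def numSeen {N : ℕ} (ω : Equiv.Perm (Fin N)) : ℕ := if mu0 ω ≤ N then N - 1 else N

/-- The moment at which the `j`-th object seen by Player 2 appears. -/
def seenAt {N : ℕ} (ω : Equiv.Perm (Fin N)) (j : ℕ) : ℕ := if j < mu0 ω then j else j + 1

/-- The rank of the `j`-th object seen by Player 2 among the first `j` objects seen by him. -/
def seenRank {N : ℕ} (ω : Equiv.Perm (Fin N)) (j : ℕ) : ℕ :=
  #{i ∈ Icc 1 j | absRank ω (seenAt ω i) ≤ absRank ω (seenAt ω j)}

/-- What Player 2 knows after seeing `j` objects: their successive ranks. -/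
def hist {N : ℕ} (ω : Equiv.Perm (Fin N)) (j : ℕ) : List ℕ :=
  (List.range j).map fun i => seenRank ω (i + 1)

/-- The event that the first `h.length` objects seen by Player 2 give the history `h`. -/
def event (N : ℕ) (h : List ℕ) : Set (Equiv.Perm (Fin N)) :=
  {ω | h.length ≤ numSeen ω ∧ hist ω h.length = h}

/-- The last object in the history is a candidate, i.e. the best one seen so far by Player 2. -/
def EndsWithCandidate (h : List ℕ) : Prop := h.getLast? = some 1

/-- `h` is a history of Player 2 that can occur and that ends at a decision point. -/
def IsDecisionPoint (N : ℕ) (h : List ℕ) : Prop :=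
  (event N h).Nonempty ∧ EndsWithCandidate h

/-- A decision rule of Player 2: the set of histories at which he accepts the current object
(if he has not accepted an earlier one). -/
abbrev Strategy : Type := Set (List ℕ)

/-- Player 2 selects the best of all objects when he uses `σ` starting from the `k`-th object
seen by him, having rejected the earlier ones. -/
def WinsFrom {N : ℕ} (σ : Strategy) (k : ℕ) (ω : Equiv.Perm (Fin N)) : Prop :=
  ∃ i, k ≤ i ∧ i ≤ numSeen ω ∧ hist ω i ∈ σ ∧ (∀ l, k ≤ l → l < i → hist ω l ∉ σ) ∧
    absRank ω (seenAt ω i) = 1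

/-- The expected reward of Player 2, given the history `h`, when he uses `σ` starting from the
`k`-th object seen by him. -/
def value (N : ℕ) (σ : Strategy) (k : ℕ) (h : List ℕ) : ℝ :=
  condProb {ω | WinsFrom σ k ω} (event N h)

/-- The expected reward from accepting the last object of the history `h`. -/
def stopReward (N : ℕ) (h : List ℕ) : ℝ :=
  condProb {ω | absRank ω (seenAt ω h.length) = 1} (event N h)

/-- The expected reward from rejecting the last object of the history `h` and accepting the next
candidate to appear to Player 2 (zero if there is none). -/
def nextReward (N : ℕ) (h : List ℕ) : ℝ :=
  value N {g | EndsWithCandidate g} (h.length + 1) h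

/-- The one-step look-ahead rule: accept a candidate whenever this is at least as good as
accepting the next candidate. -/
def osla (N : ℕ) : Strategy := {h | EndsWithCandidate h ∧ nextReward N h ≤ stopReward N h}

/-- Follow `σ` for the first `n* - 1` objects and the one-step look-ahead rule afterwards. -/
def thenOsla (N : ℕ) (σ : Strategy) : Strategy :=
  {h | (h.length < nStar N ∧ h ∈ σ) ∨ (nStar N ≤ h.length ∧ h ∈ osla N)}

/-- The probability that the last object of the history `h` of Player 2 has relative rank 1
among all objects that have appeared, including the one taken by Player 1, given `h`. -/
def p (N : ℕ) (h : List ℕ) : ℝ :=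
  condProb {ω | relRank ω (seenAt ω h.length) = 1} (event N h)

/-! ### The thresholds -/

def S1 (N n : ℕ) : ℝ := ∑ k ∈ Icc (n + 1) N, 1 / ((k : ℝ) - 1)

def S2 (N n : ℕ) : ℝ := ∑ k ∈ Icc (n + 1) N, ((n : ℝ) - 1) / (((k : ℝ) - 1) * ((k : ℝ) - 2))

/-- The threshold `q_n`. -/
def q (N n : ℕ) : ℝ := S2 N n / (1 + S2 N n - S1 N n)

end SecretaryGame

end

namespace SecretaryGame

/-! The map from a permutation to its relative ranks is a bijection onto `∏ Fin (i + 1)`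
(`code_bijective`), so the relative ranks are independent and uniform, and every probability becomes
an exact count over events determined by the first `n` of them (`DetBy.ncard_inter_relRank`).

A candidate seen by Player 2 from index `n*` on cannot precede Player 1's choice, since she would
have taken it. So the `j`-th object seen appears at moment `n = j + 1`, and `1 - p` is the
conditional probability that her hidden object is still the best. Accepting wins with probability
`(n / N) * p`. Waiting for the next candidate wins with probability `(n / N) * (p * S1 + (1 - p) *
S2)`: the next candidate is the next object of relative rank 1 if the current one is the true
record, and the next object of relative rank 1 or 2 if the hidden object leads. Solving for `p`
gives `q_n`. The denominator is positive because `u_n = (n / N) * S1` from `n*` on, so `S1 < 1`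
beyond `n*`.

Each further observation cannot raise the odds of the hidden object, and a candidate lowers them
strictly (`IsDecisionPoint.p_lt`), while `q_n` decreases. This is the monotone case of optimal
stopping: the stopping sets are closed, and backward induction (`winCount_le_osla`) gives
optimality. -/

variable {N : ℕ}

/-! ### Absolute and relative ranks -/

theorem absRank_eq (ω : Equiv.Perm (Fin N)) {n : ℕ} (h1 : 1 ≤ n) (h2 : n ≤ N) :
    absRank ω n = (ω ⟨n - 1, by omega⟩ : ℕ) + 1 :=
  dif_pos ⟨h1, h2⟩

theorem absRank_inj (ω : Equiv.Perm (Fin N)) {i k : ℕ} (hi : 1 ≤ i) (hi' : i ≤ N) (hk : 1 ≤ k)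
    (hk' : k ≤ N) (h : absRank ω i = absRank ω k) : i = k := by
  rw [absRank_eq ω hi hi', absRank_eq ω hk hk'] at h
  have h2 := ω.injective (Fin.ext (Nat.succ_injective h))
  simp only [Fin.mk.injEq] at h2
  omega

theorem one_le_absRank (ω : Equiv.Perm (Fin N)) {n : ℕ} (h1 : 1 ≤ n) (h2 : n ≤ N) :
    1 ≤ absRank ω n := by
  rw [absRank_eq ω h1 h2]; omega

theorem exists_absRank_eq_one (ω : Equiv.Perm (Fin N)) (hN : 1 ≤ N) :
    ∃ m, 1 ≤ m ∧ m ≤ N ∧ absRank ω m = 1 := by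
  obtain ⟨x, hx⟩ := ω.surjective ⟨0, hN⟩
  refine ⟨x + 1, by omega, x.isLt, ?_⟩
  rw [absRank_eq ω (by omega) x.isLt]
  simp [hx]

theorem relRank_le (ω : Equiv.Perm (Fin N)) (n : ℕ) : relRank ω n ≤ n := by
  refine (card_filter_le _ _).trans ?_
  simp

theorem one_le_relRank (ω : Equiv.Perm (Fin N)) {n : ℕ} (h1 : 1 ≤ n) : 1 ≤ relRank ω n :=
  card_pos.mpr ⟨n, by simp [h1]⟩

theorem relRank_eq_one_iff (ω : Equiv.Perm (Fin N)) {n : ℕ} (h1 : 1 ≤ n) (h2 : n ≤ N) :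
    relRank ω n = 1 ↔ ∀ i, 1 ≤ i → i ≤ n → absRank ω n ≤ absRank ω i := by
  unfold relRank
  rw [card_eq_one]
  constructor
  · rintro ⟨a, ha⟩ i hi hi'
    by_contra! hlt
    have h3 : n ∈ ({a} : Finset ℕ) := ha ▸ by simp [h1]
    have h4 : i ∈ ({a} : Finset ℕ) := ha ▸ by simp [hi, hi', hlt.le]
    rw [mem_singleton] at h3 h4
    rw [h3, h4] at hlt
    exact lt_irrefl _ hlt
  · intro h
    refine ⟨n, ?_⟩
    ext i
    simp only [mem_filter, mem_Icc, mem_singleton]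
    constructor
    · rintro ⟨⟨hi, hi'⟩, hle⟩
      exact absRank_inj ω hi (hi'.trans h2) h1 h2 (le_antisymm hle (h i hi hi'))
    · rintro rfl
      exact ⟨⟨h1, le_rfl⟩, le_rfl⟩

/-- The best object is the last record; this turns absolute rank into a condition on relative ranks
alone. -/
theorem absRank_eq_one_iff (ω : Equiv.Perm (Fin N)) {k : ℕ} (h1 : 1 ≤ k) (h2 : k ≤ N) :
    absRank ω k = 1 ↔ relRank ω k = 1 ∧ ∀ l, k < l → l ≤ N → relRank ω l ≠ 1 := by
  have forward : ∀ m, 1 ≤ m → m ≤ N → absRank ω m = 1 →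
      relRank ω m = 1 ∧ ∀ l, m < l → l ≤ N → relRank ω l ≠ 1 := by
    intro m hm hm' h
    refine ⟨(relRank_eq_one_iff ω hm hm').2 fun i hi hi' => ?_, fun l hl hl' h3 => ?_⟩
    · rw [h]; exact one_le_absRank ω hi (hi'.trans hm')
    · have h4 := (relRank_eq_one_iff ω (by omega) hl').1 h3 m hm hl.le
      have h5 := one_le_absRank ω (show 1 ≤ l by omega) hl'
      have := absRank_inj ω hm hm' (by omega) hl' (by omega)
      omega
  refine ⟨forward k h1 h2, fun ⟨h3, h4⟩ => ?_⟩
  obtain ⟨m, hm, hm', h⟩ := exists_absRank_eq_one ω (h1.trans h2)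
  rcases lt_trichotomy m k with hlt | rfl | hlt
  · exact absurd h3 ((forward m hm hm' h).2 k hlt h2)
  · exact h
  · exact absurd (forward m hm hm' h).1 (h4 m hlt hm')

/-! ### Relative ranks determine the permutation -/

/-- The two orders of appearance give the same relative ranks up to moment `n`. -/
def Agree (n : ℕ) (ω ω' : Equiv.Perm (Fin N)) : Prop :=
  ∀ i, 1 ≤ i → i ≤ n → relRank ω i = relRank ω' i

theorem Agree.symm {n : ℕ} {ω ω' : Equiv.Perm (Fin N)} (h : Agree n ω ω') : Agree n ω' ω :=
  fun i hi hi' => (h i hi hi').symm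

theorem Agree.mono {m n : ℕ} {ω ω' : Equiv.Perm (Fin N)} (h : Agree n ω ω') (hmn : m ≤ n) :
    Agree m ω ω' :=
  fun i hi hi' => h i hi (hi'.trans hmn)

theorem relRank_succ (ω : Equiv.Perm (Fin N)) (n : ℕ) :
    relRank ω (n + 1) = #{i ∈ Icc 1 n | absRank ω i ≤ absRank ω (n + 1)} + 1 := by
  unfold relRank
  rw [← insert_Icc_right_eq_Icc_add_one (by omega), filter_insert, if_pos le_rfl,
    card_insert_of_notMem (by simp)]

theorem Agree.absRank_le_iff {ω ω' : Equiv.Perm (Fin N)} {n : ℕ} (hn : n ≤ N)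
    (h : Agree n ω ω') : ∀ i k, 1 ≤ i → i ≤ n → 1 ≤ k → k ≤ n →
      (absRank ω i ≤ absRank ω k ↔ absRank ω' i ≤ absRank ω' k) := by
  induction n with
  | zero => intro i k hi hi'; omega
  | succ n ih =>
    have ih := ih (by omega) (h.mono (by omega))
    have hcard := h (n + 1) (by omega) le_rfl
    rw [relRank_succ, relRank_succ] at hcard
    have heq : {i ∈ Icc 1 n | absRank ω i ≤ absRank ω (n + 1)} =
        {i ∈ Icc 1 n | absRank ω' i ≤ absRank ω' (n + 1)} := by
      -- Both sets are initial segments of the same linear order, hence nested; having equal size,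
      -- they coincide.
      by_cases hsub : {i ∈ Icc 1 n | absRank ω i ≤ absRank ω (n + 1)} ⊆
        {i ∈ Icc 1 n | absRank ω' i ≤ absRank ω' (n + 1)}
      · exact eq_of_subset_of_card_le hsub (by omega)
      · obtain ⟨x, hx, hx'⟩ := not_subset.1 hsub
        symm
        refine eq_of_subset_of_card_le (fun y hy => ?_) (by omega)
        by_contra hy'
        simp only [mem_filter, mem_Icc, not_and, not_le] at hx hx' hy hy'
        have h1 := hx' hx.1
        have h2 := hy' hy.1
        have h3 := (ih x y hx.1.1 hx.1.2 hy.1.1 hy.1.2).1 (by omega)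
        omega
    have hlast : ∀ i, 1 ≤ i → i ≤ n → (absRank ω i ≤ absRank ω (n + 1) ↔
        absRank ω' i ≤ absRank ω' (n + 1)) := by
      intro i hi hi'
      have := Finset.ext_iff.1 heq i
      simpa [hi, hi'] using this
    intro i k hi hi' hk hk'
    rcases Nat.lt_or_ge n i with h1 | h1 <;> rcases Nat.lt_or_ge n k with h2 | h2
    · obtain rfl : i = n + 1 := by omega
      obtain rfl : k = n + 1 := by omega
      simp
    · obtain rfl : i = n + 1 := by omega
      have h3 := hlast k hk h2
      have h4 : ∀ τ : Equiv.Perm (Fin N), absRank τ (n + 1) ≠ absRank τ k := fun τ h5 => by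
        have := absRank_inj τ hi hn hk (by omega) h5
        omega
      have h5 := h4 ω
      have h6 := h4 ω'
      omega
    · obtain rfl : k = n + 1 := by omega
      exact hlast i hi h1
    · exact ih i k hi h1 hk h2

/-- `ω'` composed with the inverse of `ω` is an order automorphism of `Fin N`, hence the identity.
-/
theorem Agree.eq {ω ω' : Equiv.Perm (Fin N)} (h : Agree N ω ω') : ω = ω' := by
  have hle : ∀ x y : Fin N, ω x ≤ ω y ↔ ω' x ≤ ω' y := by
    intro x y
    have := h.absRank_le_iff le_rfl (x + 1) (y + 1) (by omega) x.isLt (by omega) y.isLt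
    rw [absRank_eq _ (by omega) x.isLt, absRank_eq _ (by omega) y.isLt,
      absRank_eq _ (by omega) x.isLt, absRank_eq _ (by omega) y.isLt] at this
    simpa using this
  let e : Fin N ≃o Fin N :=
    { toEquiv := ω.symm.trans ω'
      map_rel_iff' := by
        intro a b
        have := hle (ω.symm a) (ω.symm b)
        simpa using this.symm }
  have he : e = OrderIso.refl _ := Subsingleton.elim _ _
  ext x
  have := congrArg (fun f : Fin N ≃o Fin N => f (ω x)) he
  simp [e] at this
  rw [this]

/-- The sequence of relative ranks. -/
def code (ω : Equiv.Perm (Fin N)) : (i : Fin N) → Fin ((i : ℕ) + 1) :=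
  fun i => ⟨relRank ω (i + 1) - 1, by have := relRank_le ω (i + 1); omega⟩

theorem code_bijective : Function.Bijective (code (N := N)) := by
  rw [Fintype.bijective_iff_injective_and_card]
  constructor
  · intro ω ω' h
    refine Agree.eq fun i hi hi' => ?_
    have h1 := congrArg Fin.val (congrFun h ⟨i - 1, by omega⟩)
    simp only [code, Nat.sub_add_cancel hi] at h1
    have h2 := one_le_relRank ω hi
    have h3 := one_le_relRank ω' hi
    omega
  · rw [Fintype.card_perm, Fintype.card_pi]
    simp only [Fintype.card_fin]
    rw [Fin.prod_univ_eq_prod_range (fun i => i + 1), prod_range_add_one_eq_factorial]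

/-- Any single relative rank can be changed to any admissible value. -/
theorem exists_change_relRank (ω : Equiv.Perm (Fin N)) {m c : ℕ} (hm : m ≤ N) (hc : 1 ≤ c)
    (hc' : c ≤ m) : ∃ ω' : Equiv.Perm (Fin N), relRank ω' m = c ∧
      ∀ i, 1 ≤ i → i ≤ N → i ≠ m → relRank ω' i = relRank ω i := by
  obtain ⟨ω', h⟩ := code_bijective.2
    (Function.update (code ω) ⟨m - 1, by omega⟩ ⟨c - 1, by simp only; omega⟩)
  refine ⟨ω', ?_, fun i hi hi' hne => ?_⟩
  · have h1 := congrArg Fin.val (congrFun h ⟨m - 1, by omega⟩)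
    simp only [code, Nat.sub_add_cancel (hc.trans hc'), Function.update_self] at h1
    have h2 := one_le_relRank ω' (hc.trans hc')
    omega
  · have h1 := congrArg Fin.val (congrFun h ⟨i - 1, by omega⟩)
    rw [Function.update_of_ne (by simp only [ne_eq, Fin.mk.injEq]; omega)] at h1
    simp only [code, Nat.sub_add_cancel hi] at h1
    have h2 := one_le_relRank ω hi
    have h3 := one_le_relRank ω' hi
    omega

/-! ### Independence and counting of relative ranks -/

/-- The event `A` is determined by the relative ranks up to moment `n`. -/
def DetBy (n : ℕ) (A : Set (Equiv.Perm (Fin N))) : Prop :=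
  ∀ ω ω', Agree n ω ω' → ω ∈ A → ω' ∈ A

theorem DetBy.mono {m n : ℕ} {A : Set (Equiv.Perm (Fin N))} (h : DetBy m A) (hmn : m ≤ n) :
    DetBy n A :=
  fun ω ω' ha => h ω ω' (ha.mono hmn)

theorem DetBy.inter {n : ℕ} {A B : Set (Equiv.Perm (Fin N))} (hA : DetBy n A) (hB : DetBy n B) :
    DetBy n (A ∩ B) :=
  fun ω ω' ha h => ⟨hA ω ω' ha h.1, hB ω ω' ha h.2⟩

theorem detBy_relRank (m : ℕ) (hm : 1 ≤ m) (P : ℕ → Prop) :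
    DetBy m {ω : Equiv.Perm (Fin N) | P (relRank ω m)} := by
  intro ω ω' h hω
  simpa only [Set.mem_ofPred_eq, ← h m hm le_rfl] using hω

theorem ncard_eq_sum_fibers {α : Type*} [Finite α] (A : Set α) (f : α → ℕ) (t : Finset ℕ)
    (hf : ∀ a ∈ A, f a ∈ t) : A.ncard = ∑ c ∈ t, (A ∩ {a | f a = c}).ncard := by
  classical
  have hA := Set.toFinite A
  rw [Set.ncard_eq_toFinset_card A hA,
    card_eq_sum_card_fiberwise (f := f) (t := t) (fun a ha => hf a (by simpa using ha))]
  refine sum_congr rfl fun c _ => ?_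
  rw [← Set.ncard_coe_finset]
  congr 1
  ext a
  simp

/-- The next relative rank is uniform and independent of the earlier ones. -/
theorem DetBy.ncard_inter_relRank {n c : ℕ} {A : Set (Equiv.Perm (Fin N))} (hA : DetBy n A)
    (hn : n + 1 ≤ N) (hc : 1 ≤ c) (hc' : c ≤ n + 1) :
    (n + 1) * (A ∩ {ω | relRank ω (n + 1) = c}).ncard = A.ncard := by
  -- Resetting one relative rank from `d` to `e` is injective and stays in `A`, so all fibres have
  -- the same size.
  have hle : ∀ d, 1 ≤ d → d ≤ n + 1 → ∀ e, 1 ≤ e → e ≤ n + 1 →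
      (A ∩ {ω | relRank ω (n + 1) = d}).ncard ≤ (A ∩ {ω | relRank ω (n + 1) = e}).ncard := by
    intro d _ _ e he he'
    choose f hf hf' using fun ω : Equiv.Perm (Fin N) => exists_change_relRank ω hn he he'
    refine Set.ncard_le_ncard_of_injOn f ?_ ?_ (Set.toFinite _)
    · rintro ω ⟨hω, -⟩
      exact ⟨hA ω _ (fun i hi hi' => (hf' ω i hi (by omega) (by omega)).symm) hω, hf ω⟩
    · rintro ω ⟨-, h1⟩ τ ⟨-, h2⟩ h
      refine Agree.eq fun i hi hi' => ?_
      by_cases hin : i = n + 1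
      · subst hin
        exact h1.trans h2.symm
      · rw [← hf' ω i hi hi' hin, ← hf' τ i hi hi' hin, h]
  rw [ncard_eq_sum_fibers A (fun ω => relRank ω (n + 1)) (Icc 1 (n + 1))
    fun ω _ => mem_Icc.2 ⟨one_le_relRank ω (by omega), relRank_le ω _⟩,
    sum_congr rfl fun d hd => le_antisymm
      (hle d (mem_Icc.1 hd).1 (mem_Icc.1 hd).2 c hc hc')
      (hle c hc hc' d (mem_Icc.1 hd).1 (mem_Icc.1 hd).2)]
  simp

theorem DetBy.ncard_inter_relRank_ne_one {n : ℕ} {A : Set (Equiv.Perm (Fin N))} (hA : DetBy n A)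
    (hn : n + 1 ≤ N) :
    (n + 1) * (A ∩ {ω | relRank ω (n + 1) ≠ 1}).ncard = n * A.ncard := by
  have h1 := hA.ncard_inter_relRank hn le_rfl (by omega)
  have h2 := Set.ncard_inter_add_ncard_sdiff_eq_ncard A {ω | relRank ω (n + 1) = 1} (Set.toFinite _)
  have h3 : A \ {ω | relRank ω (n + 1) = 1} = A ∩ {ω | relRank ω (n + 1) ≠ 1} := rfl
  rw [h3] at h2
  nlinarith

theorem DetBy.ncard_inter_relRank_gt_two {n : ℕ} {A : Set (Equiv.Perm (Fin N))}
    (hA : DetBy n A) (hn : n + 1 ≤ N) (h1n : 1 ≤ n) :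
    (n + 1) * (A ∩ {ω | 2 < relRank ω (n + 1)}).ncard + A.ncard = n * A.ncard := by
  have h1 := hA.ncard_inter_relRank_ne_one hn
  have h2 := hA.ncard_inter_relRank hn (c := 2) (by omega) (by omega)
  have h3 := Set.ncard_inter_add_ncard_sdiff_eq_ncard (A ∩ {ω | relRank ω (n + 1) ≠ 1})
    {ω | relRank ω (n + 1) = 2} (Set.toFinite _)
  have h4 : A ∩ {ω | relRank ω (n + 1) ≠ 1} ∩ {ω | relRank ω (n + 1) = 2} =
      A ∩ {ω | relRank ω (n + 1) = 2} := by
    ext ω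
    simp only [Set.mem_inter_iff, Set.mem_ofPred_eq]
    constructor
    · rintro ⟨⟨h, -⟩, h'⟩
      exact ⟨h, h'⟩
    · rintro ⟨h, h'⟩
      exact ⟨⟨h, by omega⟩, h'⟩
  have h5 : (A ∩ {ω | relRank ω (n + 1) ≠ 1}) \ {ω | relRank ω (n + 1) = 2} =
      A ∩ {ω | 2 < relRank ω (n + 1)} := by
    ext ω
    have := one_le_relRank ω (show 1 ≤ n + 1 by omega)
    simp only [Set.mem_inter_iff, Set.mem_sdiff, Set.mem_ofPred_eq]
    constructor
    · rintro ⟨⟨h, _⟩, _⟩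
      exact ⟨h, by omega⟩
    · rintro ⟨h, h'⟩
      exact ⟨⟨h, by omega⟩, by omega⟩
  rw [h4, h5] at h3
  nlinarith

theorem detBy_forall {n m : ℕ} (P : ℕ → Prop) :
    DetBy m {ω : Equiv.Perm (Fin N) | ∀ l, n < l → l ≤ m → P (relRank ω l)} := by
  intro ω ω' h hω l hl hl'
  rw [← h l (by omega) hl']
  exact hω l hl hl'

theorem inter_forall_succ {n m : ℕ} (hnm : n ≤ m) (A : Set (Equiv.Perm (Fin N))) (P : ℕ → Prop) :
    A ∩ {ω | ∀ l, n < l → l ≤ m + 1 → P (relRank ω l)} =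
      A ∩ {ω | ∀ l, n < l → l ≤ m → P (relRank ω l)} ∩ {ω | P (relRank ω (m + 1))} := by
  ext ω
  simp only [Set.mem_inter_iff, Set.mem_ofPred_eq, and_assoc]
  refine and_congr_right fun _ => ⟨fun h => ⟨fun l hl hl' => h l hl (by omega),
    h _ (by omega) le_rfl⟩, fun ⟨h, h'⟩ l hl hl' => ?_⟩
  rcases Nat.lt_or_ge m l with h1 | h1
  · obtain rfl : l = m + 1 := by omega
    exact h'
  · exact h l hl h1

theorem inter_forall_self {n : ℕ} (A : Set (Equiv.Perm (Fin N))) (P : ℕ → Prop) :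
    A ∩ {ω | ∀ l, n < l → l ≤ n → P (relRank ω l)} = A := by
  ext ω
  simp only [Set.mem_inter_iff, Set.mem_ofPred_eq, and_iff_left_iff_imp]
  intro _ l hl hl'
  omega

/-- The factors `(k - 1) / k` for `n < k ≤ m` telescope to `n / m`. -/
theorem DetBy.ncard_inter_forall_ne_one {n m : ℕ} {A : Set (Equiv.Perm (Fin N))} (hA : DetBy n A)
    (hnm : n ≤ m) (hm : m ≤ N) :
    m * (A ∩ {ω | ∀ l, n < l → l ≤ m → relRank ω l ≠ 1}).ncard = n * A.ncard := by
  induction m, hnm using Nat.le_induction with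
  | base => rw [inter_forall_self A (· ≠ 1)]
  | succ m hnm ih =>
    rw [inter_forall_succ hnm A (· ≠ 1),
      ((hA.mono hnm).inter (detBy_forall (· ≠ 1))).ncard_inter_relRank_ne_one hm]
    exact ih (by omega)

/-- The factors `(k - 2) / k` telescope to `n (n - 1) / (m (m - 1))`. -/
theorem DetBy.ncard_inter_forall_gt_two {n m : ℕ} {A : Set (Equiv.Perm (Fin N))} (hA : DetBy n A)
    (h1n : 1 ≤ n) (hnm : n ≤ m) (hm : m ≤ N) :
    (m : ℝ) * (m - 1) * (A ∩ {ω | ∀ l, n < l → l ≤ m → 2 < relRank ω l}).ncard =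
      n * (n - 1) * A.ncard := by
  induction m, hnm using Nat.le_induction with
  | base => rw [inter_forall_self A (2 < ·)]
  | succ m hnm ih =>
    have h := ((hA.mono hnm).inter (detBy_forall (n := n) (2 < ·))).ncard_inter_relRank_gt_two
      hm (by omega)
    rw [inter_forall_succ hnm A (2 < ·), ← ih (by omega)]
    have h' := congrArg (Nat.cast (R := ℝ)) h
    push_cast at h' ⊢
    linear_combination (m : ℝ) * h'

/-- Any later object is the best one with probability `1 / N`. -/
theorem DetBy.ncard_inter_absRank {n : ℕ} {A : Set (Equiv.Perm (Fin N))} (hA : DetBy n A)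
    (hn : n + 1 ≤ N) : N * (A ∩ {ω | absRank ω (n + 1) = 1}).ncard = A.ncard := by
  have h1 : A ∩ {ω | absRank ω (n + 1) = 1} = A ∩ {ω | relRank ω (n + 1) = 1} ∩
      {ω | ∀ l, n + 1 < l → l ≤ N → relRank ω l ≠ 1} := by
    ext ω
    simp only [Set.mem_inter_iff, Set.mem_ofPred_eq, absRank_eq_one_iff ω (show 1 ≤ n + 1 by omega) hn,
      and_assoc]
  rw [h1, ((hA.mono (by omega)).inter
    (detBy_relRank (n + 1) (by omega) (· = 1))).ncard_inter_forall_ne_one hn le_rfl]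
  exact hA.ncard_inter_relRank hn le_rfl (by omega)

/-! ### Player 1's threshold and stopping time -/

theorem u_of_le {n : ℕ} (h : N ≤ n) : u N n = 0 := by
  rw [u, if_neg (by omega)]

theorem u_of_lt {n : ℕ} (h : n < N) : u N n =
    1 / ((n : ℝ) + 1) * max (((n : ℝ) + 1) / N) (u N (n + 1))
      + (n : ℝ) / ((n : ℝ) + 1) * u N (n + 1) := by
  rw [u, if_pos h]

theorem u_nStar_le (N : ℕ) : u N (nStar N) ≤ (nStar N : ℝ) / N :=
  Nat.sInf_mem (s := {n : ℕ | u N n ≤ (n : ℝ) / N})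
    ⟨N, by simpa [u_of_le le_rfl] using by positivity⟩

theorem one_le_nStar (hN : 1 ≤ N) : 1 ≤ nStar N := by
  by_contra! h
  have h0 : nStar N = 0 := by omega
  have h1 := u_nStar_le N
  rw [h0, u_of_lt hN] at h1
  have h2 : (0 : ℝ) < 1 / N := by positivity
  have h3 := le_max_left ((1 : ℝ) / N) (u N 1)
  simp at h1 h3
  simp at h2
  linarith

theorem mu0_mem (ω : Equiv.Perm (Fin N)) :
    mu0 ω ∈ {n : ℕ | nStar N ≤ n ∧ n ≤ N ∧ relRank ω n = 1} ∪ {N + 1} :=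
  Nat.sInf_mem ⟨N + 1, Or.inr rfl⟩

theorem mu0_spec {ω : Equiv.Perm (Fin N)} (h : mu0 ω ≤ N) :
    nStar N ≤ mu0 ω ∧ relRank ω (mu0 ω) = 1 := by
  rcases mu0_mem ω with h1 | h1
  · exact ⟨h1.1, h1.2.2⟩
  · rw [Set.mem_singleton_iff] at h1
    omega

theorem mu0_le {ω : Equiv.Perm (Fin N)} {n : ℕ} (h1 : nStar N ≤ n) (h2 : n ≤ N)
    (h3 : relRank ω n = 1) : mu0 ω ≤ n :=
  Nat.sInf_le (Or.inl ⟨h1, h2, h3⟩)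

/-- `mu0` is a stopping time for the sequence of relative ranks. -/
theorem Agree.mu0_eq {ω ω' : Equiv.Perm (Fin N)} {n : ℕ} (h : Agree n ω ω') (hn : n ≤ N)
    (hN : 1 ≤ N) (hmu : mu0 ω ≤ n) : mu0 ω' = mu0 ω := by
  obtain ⟨h1, h2⟩ := mu0_spec (hmu.trans hn)
  have h0 := one_le_nStar hN
  have h3 : mu0 ω' ≤ mu0 ω := mu0_le h1 (hmu.trans hn) (by rw [← h2, h _ (by omega) hmu])
  obtain ⟨h4, h5⟩ := mu0_spec (show mu0 ω' ≤ N by omega)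
  exact le_antisymm h3 (mu0_le h4 (by omega) (by rw [← h5, h _ (by omega) (by omega)]))

theorem one_le_mu0 {ω : Equiv.Perm (Fin N)} (hN : 1 ≤ N) : 1 ≤ mu0 ω := by
  have h0 := one_le_nStar hN
  rcases Nat.lt_or_ge N (mu0 ω) with h | h
  · omega
  · have := (mu0_spec h).1
    omega

/-! ### Ranks seen by Player 2 and the hidden object -/

theorem seenAt_of_lt {ω : Equiv.Perm (Fin N)} {i : ℕ} (h : i < mu0 ω) : seenAt ω i = i :=
  if_pos h

theorem seenAt_of_le {ω : Equiv.Perm (Fin N)} {i : ℕ} (h : mu0 ω ≤ i) : seenAt ω i = i + 1 :=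
  if_neg (by omega)

theorem numSeen_of_le {ω : Equiv.Perm (Fin N)} (h : mu0 ω ≤ N) : numSeen ω = N - 1 :=
  if_pos h

theorem numSeen_le (ω : Equiv.Perm (Fin N)) : numSeen ω ≤ N := by
  unfold numSeen
  split_ifs <;> omega

theorem seenRank_of_lt {ω : Equiv.Perm (Fin N)} {i : ℕ} (h : i < mu0 ω) :
    seenRank ω i = relRank ω i := by
  unfold seenRank relRank
  rw [seenAt_of_lt h]
  refine congrArg card (filter_congr fun k hk => ?_)
  rw [seenAt_of_lt (by have := (mem_Icc.1 hk).2; omega)]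

theorem seenRank_le (ω : Equiv.Perm (Fin N)) (n : ℕ) : seenRank ω n ≤ n := by
  refine (card_filter_le _ _).trans ?_
  simp

theorem one_le_seenRank (ω : Equiv.Perm (Fin N)) {n : ℕ} (h1 : 1 ≤ n) : 1 ≤ seenRank ω n :=
  card_pos.mpr ⟨n, by simp [h1]⟩

/-- The rank of the object taken by Player 1 among the first `n` objects. -/
noncomputable def hiddenRank (ω : Equiv.Perm (Fin N)) (n : ℕ) : ℕ :=
  #{i ∈ Icc 1 n | absRank ω i ≤ absRank ω (mu0 ω)}

theorem hiddenRank_mu0 {ω : Equiv.Perm (Fin N)} (h : mu0 ω ≤ N) : hiddenRank ω (mu0 ω) = 1 :=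
  (mu0_spec h).2

theorem one_le_hiddenRank {ω : Equiv.Perm (Fin N)} {n : ℕ} (hN : 1 ≤ N) (h : mu0 ω ≤ n) :
    1 ≤ hiddenRank ω n :=
  card_pos.mpr ⟨mu0 ω, by simp [one_le_mu0 hN, h]⟩

theorem absRank_lt_iff_hiddenRank_lt {ω : Equiv.Perm (Fin N)} {m : ℕ} (hN : 1 ≤ N)
    (hmu : mu0 ω ≤ m) (hm : m + 1 ≤ N) :
    absRank ω (mu0 ω) < absRank ω (m + 1) ↔ hiddenRank ω m < relRank ω (m + 1) := by
  have h1 := one_le_mu0 (ω := ω) hN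
  rw [relRank_succ, Nat.lt_succ_iff, hiddenRank]
  constructor
  · intro h
    refine card_le_card fun i => ?_
    simp only [mem_filter, mem_Icc]
    omega
  · intro h
    by_contra! h2
    refine absurd h (not_le.2 (card_lt_card ?_))
    refine (ssubset_iff_of_subset fun i => ?_).2 ⟨mu0 ω, ?_, ?_⟩
    · simp only [mem_filter, mem_Icc]
      omega
    · simp [h1, hmu]
    · simp only [mem_filter, mem_Icc, not_and, not_le]
      intro _
      refine lt_of_le_of_ne h2 fun h3 => ?_
      have := absRank_inj ω (by omega) hm h1 (by omega) h3
      omega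

theorem hiddenRank_succ {ω : Equiv.Perm (Fin N)} {m : ℕ} (hN : 1 ≤ N)
    (hmu : mu0 ω ≤ m) (hm : m + 1 ≤ N) :
    hiddenRank ω (m + 1) = hiddenRank ω m + if relRank ω (m + 1) ≤ hiddenRank ω m then 1 else 0 := by
  have h := absRank_lt_iff_hiddenRank_lt hN hmu hm
  conv_lhs => unfold hiddenRank
  rw [← insert_Icc_right_eq_Icc_add_one (by omega), filter_insert]
  split_ifs with h1 h2 h2
  · rw [card_insert_of_notMem (by simp)]
    rfl
  · omega
  · omega
  · rfl

/-- Player 2's count misses only the hidden object, which matters exactly when it is better than the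
new one. -/
theorem relRank_succ_eq_seenRank {ω : Equiv.Perm (Fin N)} {m : ℕ} (hN : 1 ≤ N)
    (hmu : mu0 ω ≤ m) (hm : m + 1 ≤ N) :
    relRank ω (m + 1) = seenRank ω m + if hiddenRank ω m < relRank ω (m + 1) then 1 else 0 := by
  have h1 := one_le_mu0 (ω := ω) hN
  rw [← if_congr (absRank_lt_iff_hiddenRank_lt hN hmu hm) rfl rfl]
  have h2 : seenRank ω m =
      #{i ∈ (Icc 1 (m + 1)).erase (mu0 ω) | absRank ω i ≤ absRank ω (m + 1)} := by
    unfold seenRank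
    rw [seenAt_of_le hmu]
    refine card_bij (fun i _ => seenAt ω i) ?_ ?_ ?_
    · intro i hi
      simp only [mem_filter, mem_Icc, mem_erase] at hi ⊢
      refine ⟨?_, hi.2⟩
      unfold seenAt
      split_ifs <;> omega
    · intro i _ k _ h
      unfold seenAt at h
      split_ifs at h <;> omega
    · intro k hk
      simp only [mem_filter, mem_Icc, mem_erase] at hk
      rcases Nat.lt_or_ge k (mu0 ω) with h | h
      · have h3 := seenAt_of_lt h
        refine ⟨k, ?_, h3⟩
        simp only [mem_filter, mem_Icc, h3]
        omega
      · have h3 : seenAt ω (k - 1) = k := by rw [seenAt_of_le (by omega)]; omega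
        refine ⟨k - 1, ?_, h3⟩
        simp only [mem_filter, mem_Icc, h3]
        omega
  rw [h2, filter_erase]
  unfold relRank
  have h4 : absRank ω (mu0 ω) ≠ absRank ω (m + 1) := fun h => by
    have := absRank_inj ω h1 (by omega) (by omega) hm h
    omega
  split_ifs with h3
  · rw [card_erase_add_one]
    simp only [mem_filter, mem_Icc]
    omega
  · rw [erase_eq_of_notMem]
    · rfl
    · simp only [mem_filter, mem_Icc]
      omega

theorem Agree.hiddenRank_eq {ω ω' : Equiv.Perm (Fin N)} {n m : ℕ} (h : Agree n ω ω') (hn : n ≤ N)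
    (hN : 1 ≤ N) (hmu : mu0 ω ≤ n) (hm : m ≤ n) : hiddenRank ω' m = hiddenRank ω m := by
  have h1 := one_le_mu0 (ω := ω) hN
  unfold hiddenRank
  rw [h.mu0_eq hn hN hmu]
  refine congrArg card (filter_congr fun k hk => ?_)
  rw [mem_Icc] at hk
  exact (h.absRank_le_iff hn k _ hk.1 (by omega) h1 hmu).symm

theorem Agree.seenAt_eq {ω ω' : Equiv.Perm (Fin N)} {n : ℕ} (h : Agree n ω ω') (hn : n ≤ N)
    (hN : 1 ≤ N) (hmu : mu0 ω ≤ n) (i : ℕ) : seenAt ω' i = seenAt ω i := by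
  unfold seenAt
  rw [h.mu0_eq hn hN hmu]

theorem seenAt_le (ω : Equiv.Perm (Fin N)) (i : ℕ) : i ≤ seenAt ω i ∧ seenAt ω i ≤ i + 1 := by
  unfold seenAt
  split_ifs <;> omega

theorem Agree.seenRank_eq {ω ω' : Equiv.Perm (Fin N)} {n i : ℕ} (h : Agree n ω ω') (hn : n ≤ N)
    (hN : 1 ≤ N) (hmu : mu0 ω ≤ n) (hi : i + 1 ≤ n) : seenRank ω' i = seenRank ω i := by
  unfold seenRank
  refine congrArg card (filter_congr fun k hk => ?_)
  rw [mem_Icc] at hk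
  rw [h.seenAt_eq hn hN hmu, h.seenAt_eq hn hN hmu]
  have h1 := seenAt_le ω i
  have h2 := seenAt_le ω k
  exact (h.absRank_le_iff hn _ _ (by omega) (by omega) (by omega) (by omega)).symm

/-! ### Histories and the events they define -/

theorem length_hist (ω : Equiv.Perm (Fin N)) (j : ℕ) : (hist ω j).length = j := by
  simp [hist]

theorem hist_succ (ω : Equiv.Perm (Fin N)) (j : ℕ) :
    hist ω (j + 1) = hist ω j ++ [seenRank ω (j + 1)] := by
  simp [hist, List.range_succ]

theorem take_hist (ω : Equiv.Perm (Fin N)) {l j : ℕ} (h : l ≤ j) :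
    (hist ω j).take l = hist ω l := by
  simp [hist, ← List.map_take, List.take_range, h]

theorem endsWithCandidate_hist {ω : Equiv.Perm (Fin N)} {j : ℕ} (hj : 1 ≤ j) :
    EndsWithCandidate (hist ω j) ↔ seenRank ω j = 1 := by
  obtain ⟨j, rfl⟩ := Nat.exists_eq_add_of_le' hj
  simp [EndsWithCandidate, hist_succ]

theorem Agree.hist_eq {ω ω' : Equiv.Perm (Fin N)} {n j : ℕ} (h : Agree n ω ω') (hn : n ≤ N)
    (hN : 1 ≤ N) (hmu : mu0 ω ≤ n) (hj : j + 1 ≤ n) : hist ω' j = hist ω j := by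
  unfold hist
  refine List.map_congr_left fun i hi => ?_
  rw [List.mem_range] at hi
  exact h.seenRank_eq hn hN hmu (by omega)

theorem mem_event {h : List ℕ} {ω : Equiv.Perm (Fin N)} :
    ω ∈ event N h ↔ h.length ≤ numSeen ω ∧ hist ω h.length = h :=
  Iff.rfl

theorem mem_event_concat {h : List ℕ} {r : ℕ} {ω : Equiv.Perm (Fin N)} :
    ω ∈ event N (h ++ [r]) ↔
      ω ∈ event N h ∧ h.length + 1 ≤ numSeen ω ∧ seenRank ω (h.length + 1) = r := by
  simp only [mem_event, List.length_append, List.length_singleton, hist_succ]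
  constructor
  · rintro ⟨h1, h2⟩
    obtain ⟨h3, h4⟩ := List.append_inj' h2 rfl
    exact ⟨⟨by omega, h3⟩, h1, by simpa using h4⟩
  · rintro ⟨⟨_, h3⟩, h1, h4⟩
    exact ⟨h1, by rw [h3, h4]⟩

theorem mem_event_of_prefix {h h' : List ℕ} {ω : Equiv.Perm (Fin N)} (hp : h <+: h')
    (hω : ω ∈ event N h') : ω ∈ event N h := by
  have h1 := hp.length_le
  refine ⟨h1.trans hω.1, ?_⟩
  rw [← take_hist ω h1, hω.2]
  exact (List.prefix_iff_eq_take.1 hp).symm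

/-- Before `mu0` the ranks seen are the true relative ranks, so Player 1 would herself have taken
such a candidate. -/
theorem mu0_le_of_seenRank {ω : Equiv.Perm (Fin N)} {j : ℕ} (h1 : nStar N ≤ j)
    (h2 : j ≤ numSeen ω) (h3 : seenRank ω j = 1) : mu0 ω ≤ j := by
  by_contra! h
  rw [seenRank_of_lt h] at h3
  have := mu0_le h1 (h2.trans (numSeen_le ω)) h3
  omega

/-- When the history `h` has been observed, Player 1 has certainly taken her object before the
last object in `h` appeared. -/
def Late (N : ℕ) (h : List ℕ) : Prop :=
  ∀ ω ∈ event N h, mu0 ω ≤ h.length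

theorem late_of_endsWithCandidate {h : List ℕ} (hN : 1 ≤ N) (hl : nStar N ≤ h.length)
    (hd : EndsWithCandidate h) : Late N h := by
  intro ω hω
  have h0 := one_le_nStar hN
  refine mu0_le_of_seenRank hl hω.1 ?_
  rw [← hω.2] at hd
  exact (endsWithCandidate_hist (by omega)).1 hd

theorem Late.of_prefix {h h' : List ℕ} (hh : Late N h) (hp : h <+: h') : Late N h' :=
  fun ω hω => (hh ω (mem_event_of_prefix hp hω)).trans hp.length_le

theorem Late.numSeen_eq {h : List ℕ} (hh : Late N h) {ω : Equiv.Perm (Fin N)}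
    (hω : ω ∈ event N h) : numSeen ω = N - 1 :=
  numSeen_of_le ((hh ω hω).trans (hω.1.trans (numSeen_le ω)))

theorem Late.length_lt {h : List ℕ} (hN : 1 ≤ N) (hh : Late N h) {ω : Equiv.Perm (Fin N)}
    (hω : ω ∈ event N h) : h.length + 1 ≤ N := by
  have h1 := hh.numSeen_eq hω
  have h2 := hω.1
  omega

/-- Since one object is hidden, the last of `h.length` seen objects appears at moment `h.length +
1`. -/
theorem Late.detBy_event {h : List ℕ} (hN : 1 ≤ N) (hh : Late N h) :
    DetBy (h.length + 1) (event N h) := by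
  intro ω ω' ha hω
  have h1 := hh ω hω
  have h2 := hh.length_lt hN hω
  refine ⟨?_, ?_⟩
  · rw [numSeen_of_le (by rw [ha.mu0_eq h2 hN (by omega)]; omega)]
    omega
  · rw [ha.hist_eq h2 hN (by omega) le_rfl]
    exact hω.2

/-! ### Effect of one more observation on the hidden object -/

/-- The history `h` has been observed and the object taken by Player 1 is the best one so far. -/
def hiddenBest (N : ℕ) (h : List ℕ) : Set (Equiv.Perm (Fin N)) :=
  event N h ∩ {ω | hiddenRank ω (h.length + 1) = 1}

theorem Late.detBy_hiddenBest {h : List ℕ} (hN : 1 ≤ N) (hh : Late N h) :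
    DetBy (h.length + 1) (hiddenBest N h) := by
  rintro ω ω' ha ⟨hω, hω'⟩
  refine ⟨hh.detBy_event hN _ _ ha hω, ?_⟩
  have h1 := hh ω hω
  exact (ha.hiddenRank_eq (hh.length_lt hN hω) hN (by omega) le_rfl).trans hω'

theorem seenRank_eq_iff {ω : Equiv.Perm (Fin N)} {m : ℕ} (hN : 1 ≤ N)
    (hmu : mu0 ω ≤ m) (hm : m + 1 ≤ N) (r : ℕ) :
    seenRank ω m = r ↔ (relRank ω (m + 1) = r ∧ r ≤ hiddenRank ω m) ∨
      (relRank ω (m + 1) = r + 1 ∧ hiddenRank ω m ≤ r) := by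
  have h1 := relRank_succ_eq_seenRank hN hmu hm
  split_ifs at h1 <;> omega

/-- The hidden object stays best only if the new object falls below it, which shifts the seen rank
`r` to `r + 1`. -/
theorem Late.hiddenBest_concat {h : List ℕ} (hN : 1 ≤ N) (hh : Late N h)
    (hlen : h.length + 2 ≤ N) {r : ℕ} (hr : 1 ≤ r) :
    hiddenBest N (h ++ [r]) = hiddenBest N h ∩ {ω | relRank ω (h.length + 2) = r + 1} := by
  ext ω
  simp only [hiddenBest, Set.mem_inter_iff, mem_event_concat, Set.mem_ofPred_eq,
    List.length_append, List.length_singleton]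
  constructor
  · rintro ⟨⟨h1, h2, h3⟩, h4⟩
    have hmu := hh ω h1
    have h5 := hiddenRank_succ (ω := ω) (m := h.length + 1) hN (by omega) hlen
    have h6 := (seenRank_eq_iff (ω := ω) (m := h.length + 1) hN (by omega) hlen r).1 h3
    have h7 := one_le_hiddenRank (ω := ω) (n := h.length + 1) hN (by omega)
    rw [h4] at h5
    split_ifs at h5 with h8
    · omega
    · exact ⟨⟨h1, by omega⟩, show relRank ω (h.length + 1 + 1) = r + 1 by omega⟩
  · rintro ⟨⟨h1, h2⟩, h3⟩
    have hmu := hh ω h1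
    have h5 := hiddenRank_succ (ω := ω) (m := h.length + 1) hN (by omega) hlen
    rw [if_neg (by rw [show relRank ω (h.length + 1 + 1) = r + 1 from h3]; omega)] at h5
    refine ⟨⟨h1, ?_, ?_⟩, by rw [h5, h2]⟩
    · rw [hh.numSeen_eq h1]
      omega
    · rw [seenRank_eq_iff hN (by omega) hlen]
      exact Or.inr ⟨h3, by omega⟩

theorem Late.ncard_hiddenBest_concat {h : List ℕ} (hN : 1 ≤ N) (hh : Late N h)
    (hlen : h.length + 2 ≤ N) {r : ℕ} (hr : 1 ≤ r) (hr' : r ≤ h.length + 1) :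
    (h.length + 2) * (hiddenBest N (h ++ [r])).ncard = (hiddenBest N h).ncard := by
  rw [hh.hiddenBest_concat hN hlen hr]
  exact (hh.detBy_hiddenBest hN).ncard_inter_relRank hlen (by omega) (by omega)

theorem detBy_hiddenRank {A : Set (Equiv.Perm (Fin N))} {n : ℕ} (hN : 1 ≤ N) (hn : n ≤ N)
    (hA : DetBy n A) (hmu : ∀ ω ∈ A, mu0 ω ≤ n) (P : ℕ → Prop) :
    DetBy n (A ∩ {ω | P (hiddenRank ω n)}) := by
  rintro ω ω' ha ⟨hω, hω'⟩
  refine ⟨hA _ _ ha hω, ?_⟩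
  rwa [Set.mem_ofPred_eq, ha.hiddenRank_eq hn hN (hmu ω hω) le_rfl]

/-- Whatever the hidden rank, some value of the next relative rank yields seen rank `r`: `r` if `r`
is at most the hidden rank, otherwise `r + 1`. -/
theorem Late.ncard_event_le_concat {h : List ℕ} (hN : 1 ≤ N) (hh : Late N h)
    (hlen : h.length + 2 ≤ N) {r : ℕ} (hr : 1 ≤ r) (hr' : r ≤ h.length + 1) :
    (event N h).ncard ≤ (h.length + 2) * (event N (h ++ [r])).ncard := by
  have hmu : ∀ ω ∈ event N h, mu0 ω ≤ h.length + 1 := fun ω hω => (hh ω hω).trans (by omega)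
  have h1 := (detBy_hiddenRank hN (by omega) (hh.detBy_event hN) hmu
    (r ≤ ·)).ncard_inter_relRank hlen (c := r) hr (by omega)
  have h2 := (detBy_hiddenRank hN (by omega) (hh.detBy_event hN) hmu
    (¬ r ≤ ·)).ncard_inter_relRank hlen (c := r + 1) (by omega) (by omega)
  have h3 := Set.ncard_inter_add_ncard_sdiff_eq_ncard (event N h)
    {ω | r ≤ hiddenRank ω (h.length + 1)} (Set.toFinite _)
  have h4 : event N h \ {ω | r ≤ hiddenRank ω (h.length + 1)} =
    event N h ∩ {ω | ¬ r ≤ hiddenRank ω (h.length + 1)} := rfl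
  rw [h4, ← h1, ← h2, ← mul_add, ← Set.ncard_union_eq ?_ (Set.toFinite _) (Set.toFinite _)] at h3
  · rw [← h3]
    refine Nat.mul_le_mul_left _ (Set.ncard_le_ncard ?_ (Set.toFinite _))
    have hns : ∀ ω ∈ event N h, h.length + 1 ≤ numSeen ω := fun ω hω => by
      rw [hh.numSeen_eq hω]
      omega
    rintro ω (⟨⟨h5, h6⟩, h7⟩ | ⟨⟨h5, h6⟩, h7⟩)
    · exact mem_event_concat.2 ⟨h5, hns ω h5,
        (seenRank_eq_iff hN (hmu ω h5) hlen r).2 (Or.inl ⟨h7, h6⟩)⟩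
    · exact mem_event_concat.2 ⟨h5, hns ω h5,
        (seenRank_eq_iff hN (hmu ω h5) hlen r).2 (Or.inr ⟨h7, (not_le.1 h6).le⟩)⟩
  · rw [Set.disjoint_left]
    rintro ω ⟨⟨_, h6⟩, _⟩ ⟨⟨_, h7⟩, _⟩
    exact h7 h6

/-- Relative rank 1 always gives a candidate; while the hidden object leads, relative rank 2 does so
too. This surplus makes `p` increase strictly. -/
theorem Late.ncard_event_add_le_concat_one {h : List ℕ} (hN : 1 ≤ N) (hh : Late N h)
    (hlen : h.length + 2 ≤ N) :
    (event N h).ncard + (hiddenBest N h).ncard ≤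
      (h.length + 2) * (event N (h ++ [1])).ncard := by
  rw [← (hh.detBy_event hN).ncard_inter_relRank hlen (c := 1) (by omega) (by omega),
    ← (hh.detBy_hiddenBest hN).ncard_inter_relRank hlen (c := 2) (by omega) (by omega),
    ← mul_add, ← Set.ncard_union_eq ?_ (Set.toFinite _) (Set.toFinite _)]
  · refine Nat.mul_le_mul_left _ (Set.ncard_le_ncard ?_ (Set.toFinite _))
    have hmu : ∀ ω ∈ event N h, mu0 ω ≤ h.length + 1 := fun ω hω => (hh ω hω).trans (by omega)
    have hns : ∀ ω ∈ event N h, h.length + 1 ≤ numSeen ω := fun ω hω => by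
      rw [hh.numSeen_eq hω]
      omega
    rintro ω (⟨h5, h6⟩ | ⟨⟨h5, h6⟩, h7⟩)
    · exact mem_event_concat.2 ⟨h5, hns ω h5, (seenRank_eq_iff hN (hmu ω h5) hlen 1).2
        (Or.inl ⟨h6, one_le_hiddenRank hN (hmu ω h5)⟩)⟩
    · exact mem_event_concat.2 ⟨h5, hns ω h5, (seenRank_eq_iff hN (hmu ω h5) hlen 1).2
        (Or.inr ⟨h7, le_of_eq h6⟩)⟩
  · rw [Set.disjoint_left]
    rintro ω ⟨_, h6⟩ ⟨_, h7⟩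
    simp only [Set.mem_ofPred_eq] at h6 h7
    omega

theorem exists_hist_eq_hiddenRank_eq_one {ω : Equiv.Perm (Fin N)} (hN : 1 ≤ N) {m : ℕ}
    (hm : mu0 ω ≤ m) (hmN : m ≤ N) : ∃ ω' : Equiv.Perm (Fin N), mu0 ω' = mu0 ω ∧
      hist ω' (m - 1) = hist ω (m - 1) ∧ hiddenRank ω' m = 1 := by
  induction m, hm using Nat.le_induction with
  | base => exact ⟨ω, rfl, rfl, hiddenRank_mu0 hmN⟩
  | succ m hm ih =>
    obtain ⟨τ, h1, h2, h3⟩ := ih (by omega)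
    have h0 := one_le_mu0 (ω := ω) hN
    have h4 := one_le_seenRank ω (show 1 ≤ m by omega)
    have h5 := seenRank_le ω m
    -- Placing the new object just below the hidden leader keeps the seen rank unchanged.
    obtain ⟨ω', h6, h7⟩ := exists_change_relRank τ hmN (c := seenRank ω m + 1) (by omega) (by omega)
    have ha : Agree m τ ω' := fun i hi hi' => (h7 i hi (by omega) (by omega)).symm
    have hmu := ha.mu0_eq (by omega) hN (by omega)
    have h8 := ha.hiddenRank_eq (by omega) hN (by omega) le_rfl
    refine ⟨ω', by omega, ?_, ?_⟩
    · obtain ⟨k, rfl⟩ := Nat.exists_eq_add_of_le' (show 1 ≤ m by omega)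
      simp only [Nat.add_sub_cancel] at h2 ⊢
      rw [hist_succ, hist_succ, ha.hist_eq (by omega) hN (by omega) le_rfl, h2,
        (seenRank_eq_iff hN (by omega) hmN (seenRank ω (k + 1))).2 (Or.inr ⟨h6, by omega⟩)]
    · rw [hiddenRank_succ hN (by omega) hmN, if_neg (by omega)]
      omega

theorem Late.hiddenBest_nonempty {h : List ℕ} (hN : 1 ≤ N) (hh : Late N h)
    (hne : (event N h).Nonempty) : (hiddenBest N h).Nonempty := by
  obtain ⟨ω, hω⟩ := hne
  have h1 := hh ω hω
  have h2 := hh.length_lt hN hω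
  obtain ⟨ω', h3, h4, h5⟩ := exists_hist_eq_hiddenRank_eq_one (ω := ω) hN
    (m := h.length + 1) (by omega) h2
  refine ⟨ω', ⟨?_, h4.trans hω.2⟩, h5⟩
  rw [numSeen_of_le (by omega)]
  omega

/-! ### Monotonicity of `p` along histories -/

theorem relRank_eq_one_iff_hiddenRank_ne_one {ω : Equiv.Perm (Fin N)} {m : ℕ} (hN : 1 ≤ N)
    (hmu : mu0 ω ≤ m) (hm : m + 1 ≤ N) (hs : seenRank ω m = 1) :
    relRank ω (m + 1) = 1 ↔ hiddenRank ω (m + 1) ≠ 1 := by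
  have h1 := (seenRank_eq_iff hN hmu hm 1).1 hs
  have h2 := hiddenRank_succ hN hmu hm
  have h3 := one_le_hiddenRank hN hmu
  split_ifs at h2 <;> omega

theorem seenRank_of_mem_event {h : List ℕ} {ω : Equiv.Perm (Fin N)} (hl : 1 ≤ h.length)
    (hd : EndsWithCandidate h) (hω : ω ∈ event N h) : seenRank ω h.length = 1 := by
  rw [← hω.2] at hd
  exact (endsWithCandidate_hist hl).1 hd

theorem ncard_add_ncard_hiddenBest {h : List ℕ} (hN : 1 ≤ N) (hl : nStar N ≤ h.length)
    (hd : EndsWithCandidate h) :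
    (event N h ∩ {ω | relRank ω (h.length + 1) = 1}).ncard + (hiddenBest N h).ncard =
      (event N h).ncard := by
  have h0 := one_le_nStar hN
  have hh := late_of_endsWithCandidate hN hl hd
  rw [← Set.ncard_inter_add_ncard_sdiff_eq_ncard (event N h)
    {ω | relRank ω (h.length + 1) = 1} (Set.toFinite _)]
  congr 2
  ext ω
  simp only [hiddenBest, Set.mem_inter_iff, Set.mem_sdiff, Set.mem_ofPred_eq]
  refine and_congr_right fun hω => ?_
  rw [relRank_eq_one_iff_hiddenRank_ne_one hN (hh ω hω) (hh.length_lt hN hω)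
    (seenRank_of_mem_event (by omega) hd hω), not_not]

theorem condProb_congr {E E' F : Set (Equiv.Perm (Fin N))}
    (h : ∀ ω ∈ F, ω ∈ E ↔ ω ∈ E') : condProb E F = condProb E' F := by
  unfold condProb
  congr 3
  ext ω
  exact and_congr_left fun hω => h ω hω

theorem p_eq {h : List ℕ} (hN : 1 ≤ N) (hl : nStar N ≤ h.length) (hd : EndsWithCandidate h) :
    p N h = ((event N h ∩ {ω | relRank ω (h.length + 1) = 1}).ncard : ℝ) / (event N h).ncard := by
  have hh := late_of_endsWithCandidate hN hl hd
  rw [p, condProb_congr (E' := {ω | relRank ω (h.length + 1) = 1})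
    fun ω hω => by rw [Set.mem_ofPred_eq, Set.mem_ofPred_eq, seenAt_of_le (hh ω hω)]]
  rw [condProb, Set.inter_comm]

theorem IsDecisionPoint.ncard_pos {h : List ℕ} (hd : IsDecisionPoint N h) :
    0 < (event N h).ncard :=
  (Set.ncard_pos (Set.toFinite _)).2 hd.1

theorem IsDecisionPoint.p_eq_one_sub {h : List ℕ} (hN : 1 ≤ N) (hl : nStar N ≤ h.length)
    (hd : IsDecisionPoint N h) :
    p N h = 1 - ((hiddenBest N h).ncard : ℝ) / (event N h).ncard := by
  have h1 := hd.ncard_pos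
  rw [p_eq hN hl hd.2, eq_sub_iff_add_eq, ← add_div, ← Nat.cast_add,
    ncard_add_ncard_hiddenBest hN hl hd.2, div_self (by positivity)]

/-- Cross-multiplied form of a decreasing conditional probability: each observation divides the
count of `hiddenBest` exactly by the number of possible relative ranks, and that of `event` by at
most this number. -/
theorem Late.ncard_mul_le {h : List ℕ} (hN : 1 ≤ N) (hh : Late N h) (l : List ℕ) :
    (hiddenBest N (h ++ l)).ncard * (event N h).ncard ≤
      (hiddenBest N h).ncard * (event N (h ++ l)).ncard := by
  induction l using List.reverseRecOn with
  | nil => simp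
  | append_singleton l r ih =>
    rw [← List.append_assoc]
    have hg : Late N (h ++ l) := hh.of_prefix (List.prefix_append _ _)
    rcases (event N (h ++ l ++ [r])).eq_empty_or_nonempty with he | ⟨ω, hω⟩
    · rw [hiddenBest, he]
      simp
    · have h1 := mem_event_concat.1 hω
      have hlen : (h ++ l).length + 2 ≤ N := by
        have := hg.numSeen_eq h1.1
        omega
      have hr : 1 ≤ r := h1.2.2 ▸ one_le_seenRank ω (by omega)
      have hr' : r ≤ (h ++ l).length + 1 := h1.2.2 ▸ seenRank_le ω _
      have h2 := hg.ncard_hiddenBest_concat hN hlen hr hr'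
      have h3 := hg.ncard_event_le_concat hN hlen hr hr'
      refine Nat.le_of_mul_le_mul_left (c := (h ++ l).length + 2) ?_ (by omega)
      calc _ = (hiddenBest N (h ++ l)).ncard * (event N h).ncard := by rw [← h2]; ring
        _ ≤ _ := ih
        _ ≤ _ := Nat.mul_le_mul_left _ h3
        _ = _ := by ring

theorem IsDecisionPoint.p_lt {h h' : List ℕ} (hN : 1 ≤ N) (hl : nStar N ≤ h.length)
    (hd : IsDecisionPoint N h) (hd' : IsDecisionPoint N h') (hp : h <+: h') (hne : h ≠ h') :
    p N h < p N h' := by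
  have hh := late_of_endsWithCandidate hN hl hd.2
  rw [hd.p_eq_one_sub hN hl, hd'.p_eq_one_sub hN (hl.trans hp.length_le)]
  refine sub_lt_sub_left ?_ _
  have hw := hd.ncard_pos
  have hw' := hd'.ncard_pos
  rw [div_lt_div_iff₀ (by exact_mod_cast hw') (by exact_mod_cast hw)]
  norm_cast
  obtain ⟨l, rfl⟩ := hp
  induction l using List.reverseRecOn with
  | nil => simp at hne
  | append_singleton l r _ =>
    obtain ⟨ω, hω⟩ := hd'.1
    have hr : r = 1 := by
      have := hd'.2
      simpa [EndsWithCandidate, ← List.append_assoc] using this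
    subst hr
    rw [← List.append_assoc] at hω ⊢
    have hg : Late N (h ++ l) := hh.of_prefix (List.prefix_append _ _)
    have h1 := mem_event_concat.1 hω
    have hlen : (h ++ l).length + 2 ≤ N := by
      have := hg.numSeen_eq h1.1
      omega
    have h2 := hg.ncard_hiddenBest_concat hN hlen le_rfl (by omega)
    have h3 := hg.ncard_event_add_le_concat_one hN hlen
    have h4 := hh.ncard_mul_le hN l
    have h5 := (Set.ncard_pos (Set.toFinite _)).2 (hh.hiddenBest_nonempty hN hd.1)
    have h6 := (Set.ncard_pos (Set.toFinite _)).2 (hg.hiddenBest_nonempty hN ⟨ω, h1.1⟩)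
    refine Nat.lt_of_mul_lt_mul_left (a := (h ++ l).length + 2) ?_
    calc _ = (hiddenBest N (h ++ l)).ncard * (event N h).ncard := by rw [← h2]; ring
      _ ≤ _ := h4
      -- Strict because both `hiddenBest` counts are positive.
      _ < (hiddenBest N h).ncard *
          ((event N (h ++ l)).ncard + (hiddenBest N (h ++ l)).ncard) := by
        nlinarith [Nat.mul_pos h5 h6]
      _ ≤ _ := Nat.mul_le_mul_left _ h3
      _ = _ := by ring

/-! ### The sums `S1`, `S2` and the thresholds `q` -/

theorem u_antitone (N : ℕ) : Antitone (u N) := by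
  refine antitone_nat_of_succ_le fun n => ?_
  rcases Nat.lt_or_ge n N with h | h
  · rw [u_of_lt h]
    have h1 : (0 : ℝ) < (n : ℝ) + 1 := by positivity
    calc u N (n + 1) = 1 / ((n : ℝ) + 1) * u N (n + 1) + n / ((n : ℝ) + 1) * u N (n + 1) := by
          field_simp
          ring
      _ ≤ _ := by
          gcongr
          exact le_max_right _ _
  · rw [u_of_le h, u_of_le (by omega)]

theorem S1_self (N : ℕ) : S1 N N = 0 := by
  simp [S1]

theorem S1_eq_add {n : ℕ} (h : n < N) : S1 N n = 1 / n + S1 N (n + 1) := by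
  rw [S1, ← insert_Icc_add_one_left_eq_Icc (by omega), sum_insert (by simp), S1]
  simp

theorem nStar_le (N : ℕ) : nStar N ≤ N :=
  Nat.sInf_le (by simpa [u_of_le le_rfl] using by positivity)

/-- From `n*` on the maximum in the recursion is always `(n + 1) / N`, because `u` decreases while
`n / N` increases; the recursion then sums to `S1`. -/
theorem u_eq_S1 (hN : 1 ≤ N) {n : ℕ} (h1 : nStar N ≤ n) (h2 : n ≤ N) :
    u N n = n / N * S1 N n := by
  have h0 := one_le_nStar hN
  induction h2 using Nat.decreasingInduction with
  | self => rw [u_of_le le_rfl, S1_self, mul_zero]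
  | of_succ n hn ih =>
    have hn0 : (0 : ℝ) < n := by
      have : 1 ≤ n := by omega
      exact_mod_cast this
    have hN0 : (0 : ℝ) < N := by exact_mod_cast hN
    have hmax : u N (n + 1) ≤ ((n : ℝ) + 1) / N := by
      refine (u_antitone N (show nStar N ≤ n + 1 by omega)).trans ((u_nStar_le N).trans ?_)
      gcongr
      exact_mod_cast (by omega : nStar N ≤ n + 1)
    rw [u_of_lt hn, max_eq_left hmax, ih (by omega), S1_eq_add hn]
    push_cast
    field_simp

theorem S1_nStar_le_one (hN : 1 ≤ N) : S1 N (nStar N) ≤ 1 := by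
  have h0 : (0 : ℝ) < nStar N := by exact_mod_cast one_le_nStar hN
  have hN0 : (0 : ℝ) < N := by exact_mod_cast hN
  have h1 := u_nStar_le N
  rw [u_eq_S1 hN le_rfl (nStar_le N)] at h1
  exact (mul_le_iff_le_one_right (by positivity)).1 h1

theorem S1_lt_S1 {n n' : ℕ} (hn : 1 ≤ n) (hlt : n < n') (hn' : n' ≤ N) : S1 N n' < S1 N n := by
  have hn0 : (0 : ℝ) < n := by exact_mod_cast hn
  have hle : S1 N n' ≤ S1 N (n + 1) := by
    refine sum_le_sum_of_subset_of_nonneg (Icc_subset_Icc (by omega) le_rfl) fun k hk _ => ?_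
    have : (1 : ℝ) ≤ k := by exact_mod_cast (by have := (mem_Icc.1 hk).1; omega : 1 ≤ k)
    exact div_nonneg zero_le_one (by linarith)
  rw [S1_eq_add (show n < N by omega)]
  have : (0 : ℝ) < 1 / n := by positivity
  linarith

theorem S1_lt_one (hN : 1 ≤ N) {n : ℕ} (hn : nStar N < n) (hn' : n ≤ N) : S1 N n < 1 :=
  (S1_lt_S1 (one_le_nStar hN) hn hn').trans_le (S1_nStar_le_one hN)

/-- The summand is `(n - 1) * (1 / (k - 2) - 1 / (k - 1))`, so the sum telescopes. -/
theorem S2_eq {n : ℕ} (hn : 2 ≤ n) (hn' : n ≤ N) : S2 N n = ((N : ℝ) - n) / (N - 1) := by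
  unfold S2
  induction N, hn' using Nat.le_induction with
  | base => simp
  | succ m hm ih =>
    have h1 : (2 : ℝ) ≤ m := by exact_mod_cast hn.trans hm
    have h2 : (m : ℝ) - 1 ≠ 0 := by linarith
    have h3 : (m : ℝ) ≠ 0 := by linarith
    rw [sum_Icc_succ_top (by omega), ih]
    push_cast
    have h4 : (m : ℝ) + 1 - 1 = m := by ring
    have h5 : (m : ℝ) + 1 - 2 = m - 1 := by ring
    rw [h4, h5]
    field_simp
    ring

theorem S2_lt_S2 {n n' : ℕ} (hn : 2 ≤ n) (hlt : n < n') (hn' : n' ≤ N) : S2 N n' < S2 N n := by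
  rw [S2_eq hn (by omega), S2_eq (by omega) hn']
  have h1 : (2 : ℝ) ≤ N := by exact_mod_cast (by omega : 2 ≤ N)
  have h2 : (n : ℝ) < n' := by exact_mod_cast hlt
  exact div_lt_div_of_pos_right (by linarith) (by linarith)

theorem S2_nonneg {n : ℕ} (hn : 2 ≤ n) (hn' : n ≤ N) : 0 ≤ S2 N n := by
  rw [S2_eq hn hn']
  have h1 : (2 : ℝ) ≤ n := by exact_mod_cast hn
  have h2 : (n : ℝ) ≤ N := by exact_mod_cast hn'
  exact div_nonneg (by linarith) (by linarith)

theorem q_lt_q (hN : 1 ≤ N) {n n' : ℕ} (hn : nStar N < n) (hlt : n < n') (hn' : n' ≤ N) :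
    q N n' < q N n := by
  have h0 := one_le_nStar hN
  have h1 := S1_lt_one hN hn (by omega)
  have h2 := S1_lt_one hN (hn.trans hlt) hn'
  have h3 := S2_nonneg (N := N) (n := n) (by omega) (by omega)
  have h4 := S2_nonneg (N := N) (n := n') (by omega) hn'
  have h5 := S2_lt_S2 (N := N) (by omega) hlt hn'
  have h6 := S1_lt_S1 (N := N) (by omega) hlt hn'
  unfold q
  rw [div_lt_div_iff₀ (by linarith) (by linarith)]
  nlinarith

theorem q_le_iff (hN : 1 ≤ N) {n : ℕ} (hn : nStar N < n) (hn' : n ≤ N) (x : ℝ) :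
    q N n ≤ x ↔ x * S1 N n + (1 - x) * S2 N n ≤ x := by
  have h0 := one_le_nStar hN
  have h1 := S1_lt_one hN hn hn'
  have h3 := S2_nonneg (N := N) (n := n) (by omega) hn'
  rw [q, div_le_iff₀ (by linarith)]
  constructor <;> intro h <;> linarith

/-! ### Rewards of stopping and of waiting for the next candidate -/

theorem IsDecisionPoint.length_lt {h : List ℕ} (hN : 1 ≤ N) (hl : nStar N ≤ h.length)
    (hd : IsDecisionPoint N h) : h.length + 1 ≤ N := by
  obtain ⟨ω, hω⟩ := hd.1
  exact (late_of_endsWithCandidate hN hl hd.2).length_lt hN hω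

theorem IsDecisionPoint.stopReward_eq {h : List ℕ} (hN : 1 ≤ N) (hl : nStar N ≤ h.length)
    (hd : IsDecisionPoint N h) :
    stopReward N h = ((h.length + 1 : ℕ) : ℝ) / N * p N h := by
  have hh := late_of_endsWithCandidate hN hl hd.2
  have hlt := hd.length_lt hN hl
  have hA : DetBy (h.length + 1) (event N h ∩ {ω | relRank ω (h.length + 1) = 1}) :=
    (hh.detBy_event hN).inter (detBy_relRank _ (by omega) (· = 1))
  have h1 := congrArg (Nat.cast (R := ℝ)) (hA.ncard_inter_forall_ne_one hlt le_rfl)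
  have h2 : event N h ∩ {ω | relRank ω (h.length + 1) = 1} ∩
      {ω | ∀ l, h.length + 1 < l → l ≤ N → relRank ω l ≠ 1} =
      {ω | absRank ω (seenAt ω h.length) = 1} ∩ event N h := by
    ext ω
    simp only [Set.mem_inter_iff, Set.mem_ofPred_eq]
    rw [and_assoc, and_comm (b := ω ∈ event N h)]
    refine and_congr_right fun hω => ?_
    rw [seenAt_of_le (hh ω hω), absRank_eq_one_iff ω (by omega) hlt]
  rw [h2] at h1
  have hN0 : (0 : ℝ) < N := by exact_mod_cast hN
  have hw : (0 : ℝ) < (event N h).ncard := by exact_mod_cast hd.ncard_pos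
  rw [p_eq hN hl hd.2, stopReward, condProb]
  push_cast at h1 ⊢
  field_simp
  linarith

theorem ncard_eq_sum_absRank {n : ℕ} (X : Set (Equiv.Perm (Fin N)))
    (hX : ∀ ω ∈ X, ∃ k ∈ Icc n N, 1 ≤ k ∧ absRank ω k = 1) :
    X.ncard = ∑ k ∈ Icc n N, (X ∩ {ω | 1 ≤ k ∧ absRank ω k = 1}).ncard := by
  classical
  let f : Equiv.Perm (Fin N) → ℕ := fun ω =>
    if h : ∃ k ∈ Icc n N, 1 ≤ k ∧ absRank ω k = 1 then h.choose else 0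
  have hf : ∀ ω ∈ X, f ω ∈ Icc n N ∧ 1 ≤ f ω ∧ absRank ω (f ω) = 1 := fun ω hω => by
    have h := hX ω hω
    simp only [f, dif_pos h]
    exact h.choose_spec
  rw [ncard_eq_sum_fibers X f (Icc n N) fun ω hω => (hf ω hω).1]
  refine sum_congr rfl fun k hk => congrArg _ (Set.ext fun ω => and_congr_right fun hω => ?_)
  obtain ⟨h1, h2, h3⟩ := hf ω hω
  rw [mem_Icc] at hk h1
  constructor
  · rintro rfl
    exact ⟨h2, h3⟩
  · rintro ⟨h4, h5⟩
    exact absRank_inj ω h2 h1.2 h4 hk.2 (h3.trans h5.symm)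

/-- The best object is itself a candidate when seen, so waiting wins exactly when no candidate comes
before it. -/
theorem winsFrom_candidate_iff {ω : Equiv.Perm (Fin N)} (hN : 1 ≤ N) {n m : ℕ} (hmu : mu0 ω ≤ n)
    (hnm : n ≤ m) (hm : m + 1 ≤ N) (hbest : absRank ω (m + 1) = 1) :
    WinsFrom {g | EndsWithCandidate g} n ω ↔ ∀ l, n < l → l ≤ m → seenRank ω (l - 1) ≠ 1 := by
  have h0 := one_le_mu0 (ω := ω) hN
  have hns : numSeen ω = N - 1 := numSeen_of_le (by omega)
  constructor
  · rintro ⟨i, h1, h2, h3, h4, h5⟩ l hl hl'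
    rw [seenAt_of_le (by omega)] at h5
    have h6 := absRank_inj ω (by omega) (by omega) (by omega) hm (h5.trans hbest.symm)
    have h7 := h4 (l - 1) (by omega) (by omega)
    rwa [Set.mem_ofPred_eq, endsWithCandidate_hist (by omega)] at h7
  · intro h
    refine ⟨m, hnm, by omega, ?_, fun l hl hl' => ?_, by rwa [seenAt_of_le (by omega)]⟩
    · rw [Set.mem_ofPred_eq, endsWithCandidate_hist (by omega),
        seenRank_eq_iff hN (by omega) hm]
      exact Or.inl ⟨((absRank_eq_one_iff ω (by omega) hm).1 hbest).1,
        one_le_hiddenRank hN (by omega)⟩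
    · rw [Set.mem_ofPred_eq, endsWithCandidate_hist (by omega)]
      exact h (l + 1) (by omega) (by omega)

theorem hiddenRank_mono {ω : Equiv.Perm (Fin N)} {n m : ℕ} (hnm : n ≤ m) :
    hiddenRank ω n ≤ hiddenRank ω m :=
  card_le_card (filter_subset_filter _ (Icc_subset_Icc le_rfl hnm))

/-- Once beaten, the hidden object never leads again, so candidates are exactly the true records. -/
theorem forall_seenRank_ne_one_iff_of_ne {ω : Equiv.Perm (Fin N)} (hN : 1 ≤ N) {n m : ℕ}
    (hmu : mu0 ω ≤ n) (hm : m ≤ N) (hh : hiddenRank ω n ≠ 1) :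
    (∀ l, n < l → l ≤ m → seenRank ω (l - 1) ≠ 1) ↔
      ∀ l, n < l → l ≤ m → relRank ω l ≠ 1 := by
  refine forall₃_congr fun l hl hl' => not_congr ?_
  obtain ⟨l, rfl⟩ := Nat.exists_eq_add_of_le' (show 1 ≤ l by omega)
  have h1 := one_le_hiddenRank hN hmu
  have h2 : hiddenRank ω n ≤ hiddenRank ω l := hiddenRank_mono (by omega)
  rw [Nat.add_sub_cancel, seenRank_eq_iff hN (by omega) (by omega)]
  omega

/-- While the hidden object leads, candidates are the objects of relative rank 1 or 2; if none
occurs, it goes on leading. -/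
theorem forall_seenRank_ne_one_iff_of_eq {ω : Equiv.Perm (Fin N)} (hN : 1 ≤ N) {n m : ℕ}
    (hmu : mu0 ω ≤ n) (hm : m ≤ N) (hh : hiddenRank ω n = 1) :
    (∀ l, n < l → l ≤ m → seenRank ω (l - 1) ≠ 1) ↔
      ∀ l, n < l → l ≤ m → 2 < relRank ω l := by
  constructor
  · intro h
    have key : ∀ k, n ≤ k → k ≤ m →
        hiddenRank ω k = 1 ∧ ∀ l, n < l → l ≤ k → 2 < relRank ω l := by
      intro k hk
      induction k, hk using Nat.le_induction with
      | base => exact fun _ => ⟨hh, fun l hl hl' => by omega⟩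
      | succ k hk ih =>
        intro hkm
        obtain ⟨h1, h2⟩ := ih (by omega)
        have h3 := h (k + 1) (by omega) hkm
        rw [Nat.add_sub_cancel, ne_eq, seenRank_eq_iff hN (by omega) (by omega)] at h3
        have h4 := one_le_relRank ω (show 1 ≤ k + 1 by omega)
        have h5 := hiddenRank_succ (ω := ω) (m := k) hN (by omega) (by omega)
        rw [if_neg (by omega)] at h5
        refine ⟨by omega, fun l hl hl' => ?_⟩
        rcases Nat.lt_or_ge k l with h6 | h6
        · obtain rfl : l = k + 1 := by omega
          omega
        · exact h2 l hl h6
    intro l hl hl'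
    exact (key l hl.le hl').2 l hl le_rfl
  · intro h l hl hl'
    obtain ⟨l, rfl⟩ := Nat.exists_eq_add_of_le' (show 1 ≤ l by omega)
    have h1 := h _ hl hl'
    rw [Nat.add_sub_cancel, ne_eq, seenRank_eq_iff hN (by omega) (by omega)]
    omega

/-- Splits according to whether the current candidate or the hidden object leads at moment `h.length
+ 1`; here `m + 1` is the moment of the best object. -/
theorem IsDecisionPoint.ncard_wins_next {h : List ℕ} (hN : 1 ≤ N) (hl : nStar N ≤ h.length)
    (hd : IsDecisionPoint N h) {m : ℕ} (hnm : h.length + 1 ≤ m) (hm : m + 1 ≤ N) :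
    ((({ω | WinsFrom {g | EndsWithCandidate g} (h.length + 1) ω} ∩ event N h) ∩
        {ω | 1 ≤ m + 1 ∧ absRank ω (m + 1) = 1}).ncard : ℝ) =
      ((h.length + 1 : ℕ) : ℝ) / N *
        ((event N h ∩ {ω | relRank ω (h.length + 1) = 1}).ncard * (1 / m) +
          (hiddenBest N h).ncard * (((h.length + 1 : ℕ) - 1) / (m * (m - 1)))) := by
  have h0 := one_le_nStar hN
  have hh := late_of_endsWithCandidate hN hl hd.2
  have hlt := hd.length_lt hN hl
  set n := h.length + 1 with hn
  set A := event N h ∩ {ω | relRank ω n = 1} with hAdef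
  set B := hiddenBest N h with hBdef
  have hA : DetBy n A := (hh.detBy_event hN).inter (detBy_relRank _ (by omega) (· = 1))
  have hB : DetBy n B := hh.detBy_hiddenBest hN
  set A' := A ∩ {ω | ∀ l, n < l → l ≤ m → relRank ω l ≠ 1}
  set B' := B ∩ {ω | ∀ l, n < l → l ≤ m → 2 < relRank ω l}
  have hA' : DetBy m A' := (hA.mono hnm).inter (detBy_forall (· ≠ 1))
  have hB' : DetBy m B' := (hB.mono hnm).inter (detBy_forall (2 < ·))
  have hAB : ∀ ω ∈ event N h, ω ∈ A ↔ hiddenRank ω n ≠ 1 := fun ω hω => by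
    rw [hAdef, Set.mem_inter_iff, Set.mem_ofPred_eq, hn,
      relRank_eq_one_iff_hiddenRank_ne_one hN (hh ω hω) hlt
        (seenRank_of_mem_event (by omega) hd.2 hω)]
    exact and_iff_right hω
  have hset : ({ω | WinsFrom {g | EndsWithCandidate g} n ω} ∩ event N h) ∩
      {ω | 1 ≤ m + 1 ∧ absRank ω (m + 1) = 1} =
      (A' ∩ {ω | absRank ω (m + 1) = 1}) ∪ (B' ∩ {ω | absRank ω (m + 1) = 1}) := by
    rw [← Set.union_inter_distrib_right]
    ext ω
    simp only [Set.mem_inter_iff, Set.mem_ofPred_eq]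
    rw [and_iff_right (show 1 ≤ m + 1 by omega)]
    refine and_congr_left fun hbest => ?_
    have hcase : ω ∈ event N h → (WinsFrom {g | EndsWithCandidate g} n ω ↔ ω ∈ A' ∪ B') := by
      intro hω
      have hmu : mu0 ω ≤ n := (hh ω hω).trans (by omega)
      rw [winsFrom_candidate_iff hN hmu hnm hm hbest]
      by_cases hr : hiddenRank ω n = 1
      · rw [forall_seenRank_ne_one_iff_of_eq hN hmu (by omega) hr]
        constructor
        · exact fun h1 => Or.inr ⟨⟨hω, hr⟩, h1⟩
        · rintro (h1 | h1)
          · exact absurd hr ((hAB ω hω).1 h1.1)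
          · exact h1.2
      · rw [forall_seenRank_ne_one_iff_of_ne hN hmu (by omega) hr]
        constructor
        · exact fun h1 => Or.inl ⟨(hAB ω hω).2 hr, h1⟩
        · rintro (h1 | h1)
          · exact h1.2
          · exact absurd h1.1.2 hr
    constructor
    · rintro ⟨h1, h2⟩
      exact (hcase h2).1 h1
    · intro h1
      have h2 : ω ∈ event N h := by
        rcases h1 with h1 | h1
        · exact h1.1.1
        · exact h1.1.1
      exact ⟨(hcase h2).2 h1, h2⟩
  have hdisj : Disjoint (A' ∩ {ω | absRank ω (m + 1) = 1})
      (B' ∩ {ω | absRank ω (m + 1) = 1}) := by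
    rw [Set.disjoint_left]
    rintro ω ⟨h1, -⟩ ⟨h2, -⟩
    exact (hAB ω h1.1.1).1 h1.1 h2.1.2
  rw [hset, Set.ncard_union_eq hdisj (Set.toFinite _) (Set.toFinite _)]
  have e1 : (N : ℝ) * (A' ∩ {ω | absRank ω (m + 1) = 1}).ncard = A'.ncard := by
    exact_mod_cast hA'.ncard_inter_absRank hm
  have e2 : (N : ℝ) * (B' ∩ {ω | absRank ω (m + 1) = 1}).ncard = B'.ncard := by
    exact_mod_cast hB'.ncard_inter_absRank hm
  have e3 : (m : ℝ) * A'.ncard = n * A.ncard := by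
    exact_mod_cast hA.ncard_inter_forall_ne_one hnm (by omega)
  have e4 : (m : ℝ) * (m - 1) * B'.ncard = n * (n - 1) * B.ncard :=
    hB.ncard_inter_forall_gt_two (by omega) hnm (by omega)
  rw [Nat.cast_add]
  have hN0 : (N : ℝ) ≠ 0 := by
    have : (0 : ℝ) < N := by exact_mod_cast hN
    exact this.ne'
  have hm2 : (2 : ℝ) ≤ m := by exact_mod_cast (by omega : 2 ≤ m)
  have hm0 : (m : ℝ) ≠ 0 := by linarith
  have hm1 : (m : ℝ) - 1 ≠ 0 := by linarith
  rw [mul_comm, ← eq_div_iff hN0] at e1 e2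
  rw [mul_comm, ← eq_div_iff hm0] at e3
  rw [mul_comm, ← eq_div_iff (mul_ne_zero hm0 hm1)] at e4
  rw [e1, e2, e3, e4]
  field_simp

theorem IsDecisionPoint.nextReward_eq {h : List ℕ} (hN : 1 ≤ N) (hl : nStar N ≤ h.length)
    (hd : IsDecisionPoint N h) :
    nextReward N h = ((h.length + 1 : ℕ) : ℝ) / N *
      (p N h * S1 N (h.length + 1) + (1 - p N h) * S2 N (h.length + 1)) := by
  have hh := late_of_endsWithCandidate hN hl hd.2
  have hw : (0 : ℝ) < (event N h).ncard := by exact_mod_cast hd.ncard_pos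
  have hp : 1 - p N h = (hiddenBest N h).ncard / (event N h).ncard := by
    rw [hd.p_eq_one_sub hN hl]
    ring
  rw [hp, p_eq hN hl hd.2, nextReward, value, condProb,
    ncard_eq_sum_absRank (n := h.length + 1 + 1)]
  · push_cast only [Nat.cast_sum]
    have hterm : ∀ k ∈ Icc (h.length + 1 + 1) N,
        ((({ω | WinsFrom {g | EndsWithCandidate g} (h.length + 1) ω} ∩ event N h) ∩
          {ω | 1 ≤ k ∧ absRank ω k = 1}).ncard : ℝ) =
        ((h.length + 1 : ℕ) : ℝ) / N *
          ((event N h ∩ {ω | relRank ω (h.length + 1) = 1}).ncard * (1 / ((k : ℝ) - 1)) +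
          (hiddenBest N h).ncard *
            (((h.length + 1 : ℕ) - 1) / (((k : ℝ) - 1) * ((k : ℝ) - 2)))) := by
      intro k hk
      rw [mem_Icc] at hk
      obtain ⟨m, rfl⟩ := Nat.exists_eq_add_of_le' (show 1 ≤ k by omega)
      rw [hd.ncard_wins_next hN hl (by omega) hk.2]
      push_cast
      ring_nf
    rw [sum_congr rfl hterm, ← mul_sum, sum_add_distrib, ← mul_sum, ← mul_sum, ← S1, ← S2]
    field_simp
  · rintro ω ⟨⟨i, h1, h2, -, -, h5⟩, hω⟩
    have hmu := hh ω hω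
    rw [hh.numSeen_eq hω] at h2
    rw [seenAt_of_le (by omega)] at h5
    exact ⟨i + 1, by rw [mem_Icc]; omega, by omega, h5⟩

/-! ### The one-step look-ahead rule and its closed stopping sets -/

theorem IsDecisionPoint.mem_osla_iff {h : List ℕ} (hN : 1 ≤ N) (hl : nStar N ≤ h.length)
    (hd : IsDecisionPoint N h) : h ∈ osla N ↔ q N (h.length + 1) ≤ p N h := by
  have hlt := hd.length_lt hN hl
  have hN0 : (0 : ℝ) < N := by exact_mod_cast hN
  rw [q_le_iff hN (by omega) hlt, osla, Set.mem_ofPred_eq, and_iff_right hd.2,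
    hd.nextReward_eq hN hl, hd.stopReward_eq hN hl]
  exact mul_le_mul_iff_of_pos_left (by positivity)

theorem IsDecisionPoint.mem_osla_of_prefix {h h' : List ℕ} (hN : 1 ≤ N) (hl : nStar N ≤ h.length)
    (hd : IsDecisionPoint N h) (hd' : IsDecisionPoint N h') (hp : h <+: h')
    (ho : h ∈ osla N) : h' ∈ osla N := by
  rcases eq_or_ne h h' with rfl | hne
  · exact ho
  have hlen : h.length < h'.length :=
    lt_of_le_of_ne hp.length_le fun h1 => hne (hp.eq_of_length h1)
  rw [hd.mem_osla_iff hN hl] at ho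
  rw [hd'.mem_osla_iff hN (by omega)]
  exact ((q_lt_q hN (by omega) (by omega) (hd'.length_lt hN (by omega))).le.trans ho).trans
    (hd.p_lt hN hl hd' hp hne).le

/-! ### Optimality by backward induction -/

theorem winsFrom_iff_of_mem {ω : Equiv.Perm (Fin N)} {σ : Strategy} {k : ℕ}
    (hk : k ≤ numSeen ω) (hσ : hist ω k ∈ σ) :
    WinsFrom σ k ω ↔ absRank ω (seenAt ω k) = 1 := by
  constructor
  · rintro ⟨i, h1, -, -, h4, h5⟩
    rcases h1.eq_or_lt with rfl | h
    · exact h5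
    · exact absurd hσ (h4 k le_rfl h)
  · exact fun h => ⟨k, le_rfl, hk, hσ, fun l h1 h2 => by omega, h⟩

theorem winsFrom_iff_succ {ω : Equiv.Perm (Fin N)} {σ : Strategy} {k : ℕ}
    (hσ : hist ω k ∉ σ) : WinsFrom σ k ω ↔ WinsFrom σ (k + 1) ω := by
  constructor
  · rintro ⟨i, h1, h2, h3, h4, h5⟩
    rcases h1.eq_or_lt with rfl | h
    · exact absurd h3 hσ
    · exact ⟨i, h, h2, h3, fun l hl hl' => h4 l (by omega) hl', h5⟩
  · rintro ⟨i, h1, h2, h3, h4, h5⟩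
    refine ⟨i, by omega, h2, h3, fun l hl hl' => ?_, h5⟩
    rcases hl.eq_or_lt with rfl | h
    · exact hσ
    · exact h4 l h hl'

theorem WinsFrom.congr {ω : Equiv.Perm (Fin N)} {σ τ : Strategy} {k : ℕ}
    (h : ∀ l, k ≤ l → l ≤ numSeen ω → (hist ω l ∈ σ ↔ hist ω l ∈ τ)) (hw : WinsFrom σ k ω) :
    WinsFrom τ k ω := by
  obtain ⟨i, h1, h2, h3, h4, h5⟩ := hw
  exact ⟨i, h1, h2, (h i h1 h2).1 h3,
    fun l hl hl' => mt (h l hl (by omega)).2 (h4 l hl hl'), h5⟩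

theorem seenRank_eq_one_of_best {ω : Equiv.Perm (Fin N)} (hN : 1 ≤ N) {j : ℕ} (hj : 1 ≤ j)
    (hj' : j ≤ numSeen ω) (hbest : absRank ω (seenAt ω j) = 1) : seenRank ω j = 1 := by
  have h1 := numSeen_le ω
  rcases Nat.lt_or_ge j (mu0 ω) with h | h
  · rw [seenRank_of_lt h]
    rw [seenAt_of_lt h] at hbest
    exact ((absRank_eq_one_iff ω hj (by omega)).1 hbest).1
  · have h2 := numSeen_of_le (ω := ω) (by omega)
    rw [seenAt_of_le h] at hbest
    rw [seenRank_eq_iff hN h (by omega)]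
    exact Or.inl ⟨((absRank_eq_one_iff ω (by omega) (by omega)).1 hbest).1,
      one_le_hiddenRank hN h⟩

theorem ncard_le_ncard_of_fibers {α β : Type*} [Finite α] (X Y : Set α) (f : α → β)
    (h : ∀ b, (X ∩ {a | f a = b}).ncard ≤ (Y ∩ {a | f a = b}).ncard) : X.ncard ≤ Y.ncard := by
  classical
  have := Fintype.ofFinite α
  have key : ∀ Z : Set α, Z.ncard = ∑ b ∈ univ.image f, (Z ∩ {a | f a = b}).ncard := by
    intro Z
    rw [Set.ncard_eq_toFinset_card Z (Set.toFinite Z),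
      card_eq_sum_card_fiberwise (f := f) (t := univ.image f) (fun a _ => by simp)]
    refine sum_congr rfl fun c _ => ?_
    rw [← Set.ncard_coe_finset]
    congr 1
    ext a
    simp
  rw [key X, key Y]
  exact sum_le_sum fun b _ => h b

/-- The number of orders of appearance compatible with `h` for which Player 2 wins. -/
noncomputable def winCount (N : ℕ) (σ : Strategy) (k : ℕ) (h : List ℕ) : ℕ :=
  ({ω | WinsFrom σ k ω} ∩ event N h : Set (Equiv.Perm (Fin N))).ncard

/-- The number of orders of appearance compatible with `h` whose last observed object is best. -/
noncomputable def stopCount (N : ℕ) (h : List ℕ) : ℕ :=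
  ({ω | absRank ω (seenAt ω h.length) = 1} ∩ event N h : Set (Equiv.Perm (Fin N))).ncard

theorem winCount_of_mem {σ : Strategy} {h : List ℕ} (hσ : h ∈ σ) :
    winCount N σ h.length h = stopCount N h := by
  unfold winCount stopCount
  congr 1
  ext ω
  refine and_congr_left fun hω => winsFrom_iff_of_mem hω.1 ?_
  rw [hω.2]
  exact hσ

theorem winCount_of_notMem {σ : Strategy} {h : List ℕ} (hσ : h ∉ σ) :
    winCount N σ h.length h = winCount N σ (h.length + 1) h := by
  unfold winCount
  congr 1
  ext ω
  refine and_congr_left fun hω => winsFrom_iff_succ ?_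
  rw [hω.2]
  exact hσ

theorem winCount_succ_le {σ τ : Strategy} {h : List ℕ}
    (hle : ∀ g : List ℕ, g.length = h.length + 1 →
      winCount N σ (h.length + 1) g ≤ winCount N τ (h.length + 1) g) :
    winCount N σ (h.length + 1) h ≤ winCount N τ (h.length + 1) h := by
  refine ncard_le_ncard_of_fibers _ _ (fun ω => hist ω (h.length + 1)) fun g => ?_
  by_cases hg : g.length = h.length + 1 ∧ g.take h.length = h
  · have key : ∀ ρ : Strategy, {ω | WinsFrom ρ (h.length + 1) ω} ∩ event N h ∩
        {ω | hist ω (h.length + 1) = g} = {ω | WinsFrom ρ (h.length + 1) ω} ∩ event N g := by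
      intro ρ
      ext ω
      simp only [Set.mem_inter_iff, Set.mem_ofPred_eq, mem_event, hg.1, and_assoc]
      refine and_congr_right fun hw => ?_
      obtain ⟨i, h1, h2, -⟩ := hw
      constructor
      · rintro ⟨-, -, h3⟩
        exact ⟨by omega, h3⟩
      · rintro ⟨-, h3⟩
        refine ⟨by omega, ?_, h3⟩
        rw [← hg.2, ← h3, take_hist ω (by omega)]
        simp [length_hist]
    rw [key σ, key τ]
    exact hle g hg.1
  · have he : {ω | WinsFrom σ (h.length + 1) ω} ∩ event N h ∩
        {ω | hist ω (h.length + 1) = g} = ∅ := by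
      refine Set.eq_empty_of_forall_notMem fun ω hω => hg ?_
      have h1 : hist ω (h.length + 1) = g := hω.2
      have h2 : hist ω h.length = h := hω.1.2.2
      rw [← h1]
      exact ⟨length_hist _ _, (take_hist ω (by omega)).trans h2⟩
    rw [he]
    simp

/-- By closedness, after an accepting history the rule accepts every later candidate. -/
theorem winCount_osla_eq_of_mem (hN : 1 ≤ N) {h : List ℕ} (hl : nStar N ≤ h.length)
    (ho : h ∈ osla N) : winCount N (osla N) (h.length + 1) h =
      winCount N {g | EndsWithCandidate g} (h.length + 1) h := by
  unfold winCount
  congr 1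
  ext ω
  refine and_congr_left fun hω => ?_
  have key : ∀ l, h.length + 1 ≤ l → l ≤ numSeen ω →
      (hist ω l ∈ osla N ↔ hist ω l ∈ {g | EndsWithCandidate g}) := by
    intro l h1 h2
    refine ⟨fun h3 => h3.1, fun h3 => ?_⟩
    have hd : IsDecisionPoint N h := ⟨⟨ω, hω⟩, ho.1⟩
    have hd' : IsDecisionPoint N (hist ω l) :=
      ⟨⟨ω, by rw [mem_event, length_hist]; exact ⟨h2, rfl⟩⟩, h3⟩
    refine hd.mem_osla_of_prefix hN hl hd' ?_ ho
    rw [List.prefix_iff_eq_take, take_hist ω (by omega)]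
    exact hω.2.symm
  exact ⟨fun hw => hw.congr key, fun hw => hw.congr fun l h1 h2 => (key l h1 h2).symm⟩

theorem nextReward_le_iff {h : List ℕ} (hne : (event N h).Nonempty) :
    nextReward N h ≤ stopReward N h ↔
      winCount N {g | EndsWithCandidate g} (h.length + 1) h ≤ stopCount N h := by
  have hw : (0 : ℝ) < (event N h).ncard := by
    exact_mod_cast (Set.ncard_pos (Set.toFinite _)).2 hne
  unfold nextReward stopReward value condProb winCount stopCount
  rw [div_le_div_iff_of_pos_right hw]
  exact Nat.cast_le

/-- Induction on `d`, a bound on the remaining steps. Where the rule accepts, its continuation is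
the next-candidate rule, worth no more than stopping; where it rejects a candidate, the
next-candidate rule already beats stopping; a non-candidate is never best. -/
theorem winCount_le_osla (hN : 1 ≤ N) (d : ℕ) : ∀ (σ : Strategy) (h : List ℕ),
    nStar N ≤ h.length → N + 1 ≤ h.length + d →
      winCount N σ h.length h ≤ winCount N (osla N) h.length h := by
  induction d with
  | zero =>
    intro σ h _ hd
    have he : event N h = ∅ := Set.eq_empty_of_forall_notMem fun ω hω => by
      have h1 := hω.1
      have h2 := numSeen_le ω
      omega
    simp [winCount, he]
  | succ d ih =>
    intro σ h hl hd
    have h0 := one_le_nStar hN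
    have hsucc : ∀ τ : Strategy,
        winCount N τ (h.length + 1) h ≤ winCount N (osla N) (h.length + 1) h := by
      refine fun τ => winCount_succ_le fun g hg => ?_
      rw [← hg]
      exact ih τ g (by omega) (by omega)
    rcases (event N h).eq_empty_or_nonempty with he | hne
    · simp [winCount, he]
    by_cases ho : h ∈ osla N
    · by_cases hσ : h ∈ σ
      · rw [winCount_of_mem hσ, winCount_of_mem ho]
      · rw [winCount_of_notMem hσ, winCount_of_mem ho]
        refine (hsucc σ).trans ?_
        rw [winCount_osla_eq_of_mem hN hl ho]
        exact (nextReward_le_iff hne).1 ho.2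
    · rw [winCount_of_notMem ho]
      by_cases hσ : h ∈ σ
      · rw [winCount_of_mem hσ]
        by_cases hc : EndsWithCandidate h
        · refine le_trans ?_ (hsucc {g | EndsWithCandidate g})
          by_contra! hlt
          exact ho ⟨hc, (nextReward_le_iff hne).2 hlt.le⟩
        · have he : {ω | absRank ω (seenAt ω h.length) = 1} ∩ event N h = ∅ := by
            refine Set.eq_empty_of_forall_notMem fun ω hω => hc ?_
            rw [← hω.2.2, endsWithCandidate_hist (by omega)]
            exact seenRank_eq_one_of_best hN (by omega) hω.2.1 hω.1
          simp [stopCount, he]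
      · rw [winCount_of_notMem hσ]
        exact hsucc σ

theorem value_le_value {σ τ : Strategy} {k : ℕ} {h : List ℕ}
    (hle : winCount N σ k h ≤ winCount N τ k h) : value N σ k h ≤ value N τ k h :=
  div_le_div_of_nonneg_right (Nat.cast_le.2 hle) (Nat.cast_nonneg _)

theorem value_le_value_osla (hN : 1 ≤ N) {h : List ℕ} (hl : nStar N ≤ h.length) (σ : Strategy) :
    value N σ h.length h ≤ value N (osla N) h.length h :=
  value_le_value (winCount_le_osla hN (N + 1) σ h hl (by omega))

theorem value_succ_le_stopReward (hN : 1 ≤ N) {h : List ℕ} (hl : nStar N ≤ h.length)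
    (hd : IsDecisionPoint N h) (ho : h ∈ osla N) (σ : Strategy) :
    value N σ (h.length + 1) h ≤ stopReward N h := by
  have h1 : winCount N σ (h.length + 1) h ≤ stopCount N h := by
    have h2 : winCount N σ (h.length + 1) h ≤ winCount N (osla N) (h.length + 1) h :=
      winCount_succ_le fun g hg => by
        rw [← hg]
        exact winCount_le_osla hN (N + 1) σ g (by omega) (by omega)
    rw [winCount_osla_eq_of_mem hN hl ho] at h2
    exact h2.trans ((nextReward_le_iff hd.1).1 ho.2)
  exact div_le_div_of_nonneg_right (Nat.cast_le.2 h1) (Nat.cast_nonneg _)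

theorem value_le_value_thenOsla (hN : 1 ≤ N) (σ : Strategy) :
    value N σ 1 [] ≤ value N (thenOsla N σ) 1 [] := by
  have h0 := one_le_nStar hN
  refine value_le_value (ncard_le_ncard_of_fibers _ _ (fun ω => hist ω (nStar N)) fun b => ?_)
  have hnil : ∀ ω : Equiv.Perm (Fin N), ω ∈ event N [] := fun ω => ⟨Nat.zero_le _, rfl⟩
  -- On each fibre either `σ` stops before `n*`, where both strategies agree, or the game
  -- effectively starts at `n*` with history `b`.
  by_cases hb : ∃ l, 1 ≤ l ∧ l < nStar N ∧ b.take l ∈ σ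
  · obtain ⟨l, hl1, hl2, hl3⟩ := hb
    refine Set.ncard_le_ncard ?_ (Set.toFinite _)
    rintro ω ⟨⟨⟨i, h1, h2, h3, h4, h5⟩, hω⟩, hf⟩
    refine ⟨⟨?_, hω⟩, hf⟩
    have hil : i ≤ l := by
      by_contra! hlt
      refine h4 l hl1 hlt ?_
      rw [← take_hist ω hl2.le, show hist ω (nStar N) = b from hf]
      exact hl3
    refine ⟨i, h1, h2, Or.inl ⟨by rw [length_hist]; omega, h3⟩, fun k hk hk' => ?_, h5⟩
    rintro (⟨-, h6⟩ | ⟨h6, -⟩)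
    · exact h4 k hk hk' h6
    · rw [length_hist] at h6
      omega
  · push Not at hb
    by_cases hlen : b.length = nStar N
    · have hkey := winCount_le_osla hN (N + 1) σ b hlen.ge (by omega)
      rw [hlen] at hkey
      have hnot : ∀ ω : Equiv.Perm (Fin N), hist ω (nStar N) = b →
          ∀ l, 1 ≤ l → l < nStar N → hist ω l ∉ σ := by
        intro ω hω l hl hl'
        rw [← take_hist ω hl'.le, hω]
        exact hb l hl hl'
      refine le_trans (Set.ncard_le_ncard ?_ (Set.toFinite _)) (hkey.trans
        (Set.ncard_le_ncard ?_ (Set.toFinite _)))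
      · rintro ω ⟨⟨⟨i, h1, h2, h3, h4, h5⟩, -⟩, hf⟩
        have hi : nStar N ≤ i := by
          by_contra! hlt
          exact hnot ω hf i h1 hlt h3
        refine ⟨⟨i, hi, h2, h3, fun l hl hl' => h4 l (by omega) hl', h5⟩, ?_⟩
        rw [mem_event, hlen]
        exact ⟨by omega, hf⟩
      · rintro ω ⟨⟨i, h1, h2, h3, h4, h5⟩, hω⟩
        rw [mem_event, hlen] at hω
        refine ⟨⟨⟨i, by omega, h2, Or.inr ⟨by rw [length_hist]; exact h1, h3⟩,
          fun l hl hl' => ?_, h5⟩, hnil ω⟩, hω.2⟩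
        rintro (⟨h6, h7⟩ | ⟨h6, h7⟩) <;> rw [length_hist] at h6
        · exact hnot ω hω.2 l hl h6 h7
        · exact h4 l h6 hl' h7
    · have he : {ω : Equiv.Perm (Fin N) | WinsFrom σ 1 ω} ∩ event N [] ∩
          {ω | hist ω (nStar N) = b} = ∅ := by
        refine Set.eq_empty_of_forall_notMem fun ω hω => hlen ?_
        rw [← show hist ω (nStar N) = b from hω.2, length_hist]
      rw [he]
      simp

end SecretaryGame

theorem lemma1 (N : ℕ) (hN : 1 ≤ N) :
    -- at a decision point after moment `n*` Player 2 knows the moment: it is `h.length + 1`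
    (∀ h : List ℕ, SecretaryGame.nStar N ≤ h.length → SecretaryGame.IsDecisionPoint N h →
      ∀ ω ∈ SecretaryGame.event N h,
        SecretaryGame.seenAt ω h.length = h.length + 1 ∧ h.length + 1 ≤ N) ∧
    -- the thresholds decrease
    (∀ n n' : ℕ, SecretaryGame.nStar N < n → n < n' → n' ≤ N →
      SecretaryGame.q N n' < SecretaryGame.q N n) ∧
    -- the one-step look-ahead rule accepts a candidate at moment `n` iff `p ≥ q_n`
    (∀ h : List ℕ, SecretaryGame.nStar N ≤ h.length → SecretaryGame.IsDecisionPoint N h →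
      (h ∈ SecretaryGame.osla N ↔
        SecretaryGame.q N (h.length + 1) ≤ SecretaryGame.p N h)) ∧
    -- along later decision points `p` increases and the stopping sets are closed
    (∀ h h' : List ℕ, SecretaryGame.nStar N ≤ h.length → SecretaryGame.IsDecisionPoint N h →
      SecretaryGame.IsDecisionPoint N h' → h <+: h' → h ≠ h' →
        SecretaryGame.p N h < SecretaryGame.p N h' ∧
        (h ∈ SecretaryGame.osla N → h' ∈ SecretaryGame.osla N)) ∧
    -- optimality of the one-step look-ahead rule given any history from `n*` on
    (∀ h : List ℕ, SecretaryGame.nStar N ≤ h.length → ∀ σ : SecretaryGame.Strategy,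
      SecretaryGame.value N σ h.length h ≤
        SecretaryGame.value N (SecretaryGame.osla N) h.length h) ∧
    -- accepting is optimal (no continuation after rejection does better) iff `p ≥ q_n`
    (∀ h : List ℕ, SecretaryGame.nStar N ≤ h.length → SecretaryGame.IsDecisionPoint N h →
      ((∀ σ : SecretaryGame.Strategy,
          SecretaryGame.value N σ (h.length + 1) h ≤ SecretaryGame.stopReward N h) ↔
        SecretaryGame.q N (h.length + 1) ≤ SecretaryGame.p N h)) ∧
    -- in the whole game, switching to the one-step look-ahead rule at `n*` never hurts
    (∀ σ : SecretaryGame.Strategy,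
      SecretaryGame.value N σ 1 [] ≤
        SecretaryGame.value N (SecretaryGame.thenOsla N σ) 1 []) := by
  refine ⟨fun h hl hd ω hω => ?_, fun n n' => SecretaryGame.q_lt_q hN,
    fun h hl hd => hd.mem_osla_iff hN hl, fun h h' hl hd hd' hp hne =>
      ⟨hd.p_lt hN hl hd' hp hne, hd.mem_osla_of_prefix hN hl hd' hp⟩,
    fun h hl => SecretaryGame.value_le_value_osla hN hl, fun h hl hd => ?_,
    SecretaryGame.value_le_value_thenOsla hN⟩
  · exact ⟨SecretaryGame.seenAt_of_le (SecretaryGame.late_of_endsWithCandidate hN hl hd.2 ω hω),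
      hd.length_lt hN hl⟩
  · rw [← hd.mem_osla_iff hN hl]
    -- For the forward direction, the next-candidate rule is the only continuation needed.
    exact ⟨fun hall => ⟨hd.2, hall _⟩, SecretaryGame.value_succ_le_stopReward hN hl hd⟩
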